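/- Let $K$ be a field. For an integer matrix $A$ with columns $a_1,\dots,a_n$, let $I_A=(x^{u^+}-x^{u^-}: u\in\operatorname{Ker}_{\mathbb Z}(A))\subset K[x_1,\dots,x_n]$ be its toric ideal; $I_A$ is positively graded if $\operatorname{Ker}_{\mathbb Z}(A)\cap\mathbb N^n=\{0\}$. Write $G(a_i)$ for the $i$-th row of a Gale transform of $A$ (a matrix whose columns are a basis of the lattice $\operatorname{Ker}_{\mathbb Z}(A)$); $a_i$ is free if $G(a_i)=0$. In the bouquet graph of $A$, distinct $i,j$ are adjacent if $G(a_i)$ and $G(a_j)$ are rational multiples of each other; its connected components are the bouquets, its nonempty cliques the subbouquets, and a subbouquet decomposition is a partition of the columns into subbouquets. A subbouquet is free if all its vectors are free; a non-free one is non-mixed if $G(a_i)=\lambda G(a_j)$ with $\lambda>0$ on each of its edges. To a subbouquet $B$ belongs an encoding vector $c_B\in\mathbb Z^n$ with support $B$: if $B$ is not free, $(c_B)_i=\varepsilon\, G(a_i)_j/\gcd_{l\in B}G(a_l)_j$ for $i\in B$, where $j$ is a coordinate with $G(a_i)_j\ne0$ for all $i\in B$ and $\varepsilon=\pm1$ makes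 the first nonzero entry positive; if $B$ is free, $c_B$ is any vector with support $B$ and positive first nonzero entry. Put $a_B=\sum_i (c_B)_i a_i$; the toric ideal of the matrix with columns $a_{B_1},\dots,a_{B_s}$ is the subbouquet ideal of the decomposition $B_1,\dots,B_s$. $I_A$ is stable if all non-free bouquets of $A$ are non-mixed. For $E=(e_{kl})\in\mathbb N^{p\times n}$ let $\delta_i=\max_k e_{ki}$ and $j_i=\min\{k: e_{ki}=\delta_i\}$. Let $\Sigma_r$ be the $r\times r$ matrix with $0$ on the diagonal and $1$ elsewhere, and $\varepsilon_{k,r}\in\mathbb Z^r$ the row vector of $k$ ones followed by $r-k$ zeros. Let $A_E$ be the $0/1$ matrix whose columns are divided into blocks $B_1,\dots,B_n$, with $B_i$ of size $\delta_i+1$, and with the following rows: for each $i=1,\dots,n$, with $k=j_i$, there are $\delta_i+1$ rows whose $i$-th block is $\Sigma_{\delta_i+1}$ and whose $l$-th block, for $l\ne i$, consists of $\delta_i+1$ copies of $\varepsilon_{e_{kl},\delta_l+1}$; for each $k\notin\{j_1,\dots,j_n\}$ there is one row $(\varepsilon_{e_{k1},\delta_1+1}\mid\cdots\mid\varepsilon_{e_{kn},\delta_n+1})$.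 **Theorem.** Let $D\in\mathbb Z^{m\times n}$ be such that $I_D$ is positively graded and nonzero. Then there is a matrix $E$ with entries in $\mathbb N$ and $I_E=I_D$. For every such $E$, $A_E$ is the vertex-edge incidence matrix of a hypergraph $\mathcal H$ (without repeated edges) and, writing $I_{\mathcal H}=I_{A_E}\subset T=K[y_e : e \text{ an edge}]$ and $S=K[x_1,\dots,x_n]$, the following hold. 1. $B_1,\dots,B_n$ is a subbouquet decomposition of $A_E$ with encoding vectors $c_{B_i}$ = the $0/1$ indicator vector of $B_i$. Its subbouquet ideal is $I_D$, and all of its non-free subbouquets are non-mixed (that is, $I_{\mathcal H}$ is stable with respect to this subbouquet decomposition). Moreover $I_{\mathcal H}$ is stable if and only if $I_D$ is stable. 2. The map $u\mapsto B(u)=\sum_i u_i c_{B_i}$ restricts to bijections from $\operatorname{Ker}_{\mathbb Z}(D)$, the Graver basis of $D$, the set of circuits of $D$ and the set of indispensable binomials of $I_D$ (binomials $x^{u^+}-x^{u^-}$ being identified with the vectors $u$) to the corresponding sets for $\mathcal H$. Applied elementwise, it is a bijection from the minimal Markov bases of $I_D$ to those of $I_{\mathcal H}$. Let $\varphi:S\to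 T$ be the $K$-algebra homomorphism $x_i\mapsto\prod_{e\in B_i}y_e$, so that $\varphi(x^{u^+}-x^{u^-})=y^{B(u)^+}-y^{B(u)^-}$. Then $G\mapsto\varphi(G)$ is a bijection from the set of all reduced Gröbner bases of $I_D$ (over all monomial orders) to the set of all reduced Gröbner bases of $I_{\mathcal H}$. 3. Grade $S$ and $T$ by the columns of $D$ and of $A_E$. Consider minimal graded free resolutions of $S/I_D$ and of $T/I_{\mathcal H}$, each with $F_0$ the ring itself, given by the degrees of homogeneous bases and the matrices of the maps. Such a resolution of $S/I_D$ exists, and applying $\varphi$ to all matrices (that is, $-\otimes_S T$) and an injective change of degrees $Du\mapsto A_E B(u)$, $u\in\mathbb Z^n$, is a bijection from the minimal graded free resolutions of $S/I_D$ to those of $T/I_{\mathcal H}$. Consequently $\beta_i(S/I_D)=\beta_i(T/I_{\mathcal H})$ and $\beta_{i,Du}(S/I_D)=\beta_{i,A_EB(u)}(T/I_{\mathcal H})$ for all $i\ge0$ and $u\in\mathbb Z^n$, and $\operatorname{pd}_S(S/I_D)=\operatorname{pd}_T(T/I_{\mathcal H})$. -/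

import Mathlib

open MvPolynomial

namespace ToricHypergraph

/-! ### Toric ideals and their distinguished sets of binomials -/

section Toric

variable {V ι : Type*} [Fintype ι]

/-- The lattice `Ker_ℤ(A)`. -/
def kerLattice (A : Matrix V ι ℤ) : Submodule ℤ (ι → ℤ) :=
  LinearMap.ker A.mulVecLin

/-- The binomial `x^{u⁺} - x^{u⁻}` of an integer vector `u = u⁺ - u⁻`. -/
noncomputable def binomial (K : Type*) [Field K] (u : ι → ℤ) : MvPolynomial ι K :=
  monomial (Finsupp.equivFunOnFinite.symm fun i => (u i).toNat) 1
    - monomial (Finsupp.equivFunOnFinite.symm fun i => (-u i).toNat) 1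

/-- The toric ideal `I_A = (x^{u⁺} - x^{u⁻} : u ∈ Ker_ℤ(A))`. -/
noncomputable def toricIdeal (K : Type*) [Field K] (A : Matrix V ι ℤ) : Ideal (MvPolynomial ι K) :=
  Ideal.span (binomial K '' (kerLattice A : Set (ι → ℤ)))

/-- `I_A` is positively graded: `Ker_ℤ(A) ∩ ℕ^n = {0}`. -/
def IsPositivelyGraded (A : Matrix V ι ℤ) : Prop :=
  ∀ u ∈ kerLattice A, 0 ≤ u → u = 0

/-- The Graver basis: the nonzero `u ∈ Ker_ℤ(A)` that have no conformal decomposition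
`u⁺ = v⁺ + w⁺`, `u⁻ = v⁻ + w⁻` with nonzero `v, w ∈ Ker_ℤ(A)`. -/
def graverBasis (A : Matrix V ι ℤ) : Set (ι → ℤ) :=
  {u | u ∈ kerLattice A ∧ u ≠ 0 ∧
    ∀ v ∈ kerLattice A, ∀ w ∈ kerLattice A, u⁺ = v⁺ + w⁺ → u⁻ = v⁻ + w⁻ → v = 0 ∨ w = 0}

/-- The circuits: the nonzero `u ∈ Ker_ℤ(A)` of inclusion-minimal support, with relatively prime
coordinates. -/
def circuits (A : Matrix V ι ℤ) : Set (ι → ℤ) :=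
  {u | u ∈ kerLattice A ∧ u ≠ 0 ∧ Finset.univ.gcd u = 1 ∧
    ∀ v ∈ kerLattice A, v ≠ 0 → Function.support v ⊆ Function.support u →
      Function.support v = Function.support u}

/-- A Markov basis: a finite subset of `Ker_ℤ(A)` whose binomials generate `I_A`. -/
def IsMarkovBasis (K : Type*) [Field K] (A : Matrix V ι ℤ) (M : Set (ι → ℤ)) : Prop :=
  M.Finite ∧ M ⊆ kerLattice A ∧ Ideal.span (binomial K '' M) = toricIdeal K A

/-- A Markov basis is minimal if no proper subset of it is a Markov basis. -/
def IsMinimalMarkovBasis (K : Type*) [Field K] (A : Matrix V ι ℤ) (M : Set (ι → ℤ)) : Prop :=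
  IsMarkovBasis K A M ∧ ∀ M' ⊂ M, ¬ IsMarkovBasis K A M'

/-- The (exponent vectors of the) indispensable binomials: those which belong, up to sign, to every
minimal Markov basis. -/
def indispensables (K : Type*) [Field K] (A : Matrix V ι ℤ) : Set (ι → ℤ) :=
  {u | u ∈ kerLattice A ∧ ∀ M, IsMinimalMarkovBasis K A M → u ∈ M ∨ -u ∈ M}

/-- `G` is the reduced Gröbner basis of `I` with respect to the monomial order `mo`. -/
def IsReducedGroebnerBasis {K : Type*} [Field K] (mo : MonomialOrder ι)
    (I : Ideal (MvPolynomial ι K)) (G : Set (MvPolynomial ι K)) : Prop :=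
  G ⊆ I ∧
  (∀ f ∈ I, f ≠ 0 → ∃ g ∈ G, mo.degree g ≤ mo.degree f) ∧
  (∀ g ∈ G, mo.leadingCoeff g = 1) ∧
  ∀ g ∈ G, ∀ h ∈ G, h ≠ g → ∀ s ∈ g.support, ¬ mo.degree h ≤ s

/-- The set of all reduced Gröbner bases of `I`, over all monomial orders. -/
def reducedGroebnerBases {σ K : Type*} [Fintype σ] [Field K] (I : Ideal (MvPolynomial σ K)) :
    Set (Set (MvPolynomial σ K)) :=
  {G | ∃ mo : MonomialOrder.{_, 0} σ, IsReducedGroebnerBasis mo I G}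

end Toric

/-! ### Bouquets and subbouquets -/

section Bouquet

variable {V ι : Type*} [Fintype ι]

/-- The rows `G(a_i)` of a Gale transform of `A`: the columns of the matrix `G(A)` are a `ℤ`-basis
of `Ker_ℤ(A)`. -/
noncomputable def gale (A : Matrix V ι ℤ) (i : ι) : Fin (Module.finrank ℤ (kerLattice A)) → ℤ :=
  fun j => (Module.finBasis ℤ (kerLattice A) j : ι → ℤ) i

/-- `G(a_i) = l • G(a_j)` for the rational number `l`. -/
def GaleMultiple (A : Matrix V ι ℤ) (i j : ι) (l : ℚ) : Prop :=
  ∀ k, (gale A i k : ℚ) = l * gale A j k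

/-- The bouquet graph: `i` and `j` are adjacent if `G(a_i)` is a rational multiple of `G(a_j)` and
vice versa. -/
def bouquetGraph (A : Matrix V ι ℤ) : SimpleGraph ι where
  Adj i j := i ≠ j ∧ (∃ l, GaleMultiple A i j l) ∧ ∃ l, GaleMultiple A j i l
  symm := ⟨fun _ _ h => ⟨h.1.symm, h.2.2, h.2.1⟩⟩
  loopless := ⟨fun _ h => h.1 rfl⟩

/-- The bouquets are the connected components of the bouquet graph. -/
def IsBouquet (A : Matrix V ι ℤ) (B : Set ι) : Prop :=
  ∃ C : (bouquetGraph A).ConnectedComponent, B = C.supp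

/-- A subbouquet: a clique of the bouquet graph. -/
def IsSubbouquet (A : Matrix V ι ℤ) (B : Set ι) : Prop :=
  B.Nonempty ∧ (bouquetGraph A).IsClique B

/-- A subbouquet decomposition: pairwise disjoint subbouquets that cover all the vertices. -/
def IsSubbouquetDecomposition (A : Matrix V ι ℤ) {τ : Type*} (B : τ → Set ι) : Prop :=
  (∀ t, IsSubbouquet A (B t)) ∧ Pairwise (fun s t => Disjoint (B s) (B t)) ∧ ⋃ t, B t = Set.univ

/-- All vectors in `B` are free. -/
def IsFree (A : Matrix V ι ℤ) (B : Set ι) : Prop :=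
  ∀ i ∈ B, gale A i = 0

/-- A (sub)bouquet is non-mixed if it is not free, and `G(a_i) = l G(a_j)` with `l > 0` for each of
its edges. -/
def IsNonMixed (A : Matrix V ι ℤ) (B : Set ι) : Prop :=
  ¬ IsFree A B ∧
    ∀ i ∈ B, ∀ j ∈ B, (bouquetGraph A).Adj i j → ∃ l : ℚ, 0 < l ∧ GaleMultiple A i j l

/-- `I_A` is stable: all non-free bouquets of `A` are non-mixed. -/
def IsStable (A : Matrix V ι ℤ) : Prop :=
  ∀ B, IsBouquet A B → ¬ IsFree A B → IsNonMixed A B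

/-- `c` is a bouquet-index-encoding vector `c_B` of the subbouquet `B`. If `B` is free, then `c` is
any vector with support `B` whose first nonzero coordinate is positive. If `B` is not free, then,
for a coordinate `j` in which no `G(a_i)`, `i ∈ B`, vanishes, `c_i` is `0` for `i ∉ B` and
`ε G(a_i)_j / g_j` for `i ∈ B`, where `g_j` is the gcd of the `G(a_i)_j`, `i ∈ B`, and `ε` is the
sign of `G(a_{i₀})_j` for the smallest `i₀ ∈ B`. -/
def IsEncodingVector [LinearOrder ι] (A : Matrix V ι ℤ) (B : Finset ι) (c : ι → ℤ) : Prop :=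
  (IsFree A B → Function.support c = B ∧ ∀ i₀, IsLeast (B : Set ι) i₀ → 0 < c i₀) ∧
  (¬ IsFree A B → ∃ j, (∀ i ∈ B, gale A i j ≠ 0) ∧ ∃ i₀, IsLeast (B : Set ι) i₀ ∧
    ∀ i, c i = if i ∈ B then (gale A i₀ j).sign * gale A i j / B.gcd (fun i => gale A i j) else 0)

/-- The subbouquet matrix, with columns `a_B = ∑ i, (c_B)_i a_i`. -/
def subbouquetMatrix (A : Matrix V ι ℤ) {τ : Type*} (c : τ → ι → ℤ) : Matrix V τ ℤ :=
  fun v t => ∑ i, c t i * A v i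

end Bouquet

/-- `A` is the vertex-edge incidence matrix of the hypergraph `H` with vertices `V`, the edges of
`H` being listed (without repetition) by `ι`. -/
def IsIncidenceMatrix {V ι : Type*} (H : Hypergraph V) (A : Matrix V ι ℤ) : Prop :=
  H.vertexSet = Set.univ ∧ ∃ e : ι ≃ H.edgeSet,
    ∀ v i, (v ∈ (e i : Set V) → A v i = 1) ∧ (v ∉ (e i : Set V) → A v i = 0)

/-! ### The hypergraph of a matrix of natural numbers -/

section Construction

/-- The matrix `Σ_n`, with `0` on the diagonal and `1` elsewhere. -/
def sigmaMatrix (n : ℕ) : Matrix (Fin n) (Fin n) ℤ :=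
  fun i j => if i = j then 0 else 1

/-- The row vector `ε_{k,n}` of length `n`: `k` ones followed by zeros. -/
def epsRow (k n : ℕ) : Fin n → ℤ :=
  fun j => if (j : ℕ) < k then 1 else 0

variable {p n : ℕ}

/-- The maximum `δ_i` of the `i`-th column. -/
def colMax (E : Matrix (Fin p) (Fin n) ℕ) (i : Fin n) : ℕ :=
  Finset.univ.sup fun k => E k i

/-- `k = j_i`: row `k` is the first one in which the maximum `δ_i` of column `i` appears. -/
def IsFirstMax (E : Matrix (Fin p) (Fin n) ℕ) (k : Fin p) (i : Fin n) : Prop :=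
  E k i = colMax E i ∧ ∀ k' < k, E k' i ≠ colMax E i

/-- The edges (columns): `δ_i + 1` columns for each column `i` of `E`, in this order. -/
abbrev HEdge (E : Matrix (Fin p) (Fin n) ℕ) : Type :=
  _root_.Lex (Sigma fun i : Fin n => Fin (colMax E i + 1))

/-- The vertices (rows): `δ_i + 1` rows for each pair `(k, i)` with `k = j_i`, and one row for each
`k ∉ {j_1, …, j_n}`. -/
abbrev HVertex (E : Matrix (Fin p) (Fin n) ℕ) : Type :=
  (Sigma fun q : {q : Fin p × Fin n // IsFirstMax E q.1 q.2} => Fin (colMax E q.1.2 + 1)) ⊕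
    {k : Fin p // ∀ i, ¬ IsFirstMax E k i}

/-- The incidence matrix. In the rows of `(k, i)` the `i`-th block is `Σ_{δ_i + 1}` and, for
`l ≠ i`, all rows of the `l`-th block are `ε_{E k l, δ_l + 1}`. In the row of `k ∉ {j_1, …, j_n}`
every block `l` is `ε_{E k l, δ_l + 1}`. -/
def hMatrix (E : Matrix (Fin p) (Fin n) ℕ) : Matrix (HVertex E) (HEdge E) ℤ := fun v e =>
  match v with
  | Sum.inl ⟨q, r⟩ =>
    if h : (ofLex e).1 = q.1.2 then
      sigmaMatrix (colMax E q.1.2 + 1) r (Fin.cast (by rw [h]) (ofLex e).2)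
    else epsRow (E q.1.1 (ofLex e).1) (colMax E (ofLex e).1 + 1) (ofLex e).2
  | Sum.inr k => epsRow (E k.1 (ofLex e).1) (colMax E (ofLex e).1 + 1) (ofLex e).2

/-- The `i`-th block of columns. -/
def block (E : Matrix (Fin p) (Fin n) ℕ) (i : Fin n) : Finset (HEdge E) :=
  Finset.univ.filter fun e => (ofLex e).1 = i

/-- The vector `(0, …, 0, 1, …, 1, 0, …, 0)` with ones in the `i`-th block. -/
def blockVec (E : Matrix (Fin p) (Fin n) ℕ) (i : Fin n) : HEdge E → ℤ :=
  fun e => if (ofLex e).1 = i then 1 else 0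

/-- The map `u ↦ B(u) = ∑ i, u_i c_{B_i}`. -/
def liftVec (E : Matrix (Fin p) (Fin n) ℕ) (u : Fin n → ℤ) : HEdge E → ℤ :=
  ∑ i, u i • blockVec E i

/-- The homomorphism `K[x_1, …, x_n] → K[y]` that sends `x_i` to the product of the variables of the
`i`-th block; it sends `x^{u⁺} - x^{u⁻}` to `y^{B(u)⁺} - y^{B(u)⁻}`. -/
noncomputable def liftPoly (K : Type*) [Field K] (E : Matrix (Fin p) (Fin n) ℕ) :
    MvPolynomial (Fin n) K →ₐ[K] MvPolynomial (HEdge E) K :=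
  aeval fun i => ∏ e ∈ block E i, X e

end Construction

/-! ### Graded free resolutions -/

/-- The data of a sequence of finitely generated graded free modules `F_0 ← F_1 ← F_2 ← ⋯` with
homogeneous bases: the ranks, the degrees of the basis elements, and the matrices of the maps
`F_{i+1} → F_i`. -/
@[ext]
structure FreeComplex (R Γ : Type*) where
  /-- The rank of `F_i`. -/
  rank : ℕ → ℕ
  /-- The degrees of the basis elements of `F_i`. -/
  deg : ∀ i, Fin (rank i) → Γ
  /-- The matrix of the map `F_{i+1} → F_i`. -/
  d : ∀ i, Matrix (Fin (rank i)) (Fin (rank (i + 1))) R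

/-- `F ⊗_R R'` along `φ : R → R'`, with the degrees changed by `f`. -/
def FreeComplex.baseChange {R R' Γ Γ' : Type*} (φ : R → R') (f : Γ → Γ') (F : FreeComplex R Γ) :
    FreeComplex R' Γ' where
  rank := F.rank
  deg i j := f (F.deg i j)
  d i := (F.d i).map φ

/-- The number of basis elements of degree `h` in homological degree `i`; for a minimal graded free
resolution this is the graded Betti number `β_{i,h}`. -/
noncomputable def FreeComplex.betti {R Γ : Type*} (F : FreeComplex R Γ) (i : ℕ) (h : Γ) : ℕ :=
  Nat.card {j : Fin (F.rank i) // F.deg i j = h}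

/-- `F` is a minimal graded free resolution of `S/I_A`, where `S = K[x_j : j ∈ ι]` is graded by
`deg x_j = a_j`, the `j`-th column of `A`, and `I_A` is positively graded: `F_0 = S`, the maps are
homogeneous of degree `0`, the image of `F_1` is `I_A`, the sequence is exact, and all the matrix
entries lie in the ideal of the variables. -/
structure IsMinimalGradedFreeResolution {V ι K : Type*} [Fintype ι] [Field K] (A : Matrix V ι ℤ)
    (F : FreeComplex (MvPolynomial ι K) (V → ℤ)) : Prop where
  rank_zero : F.rank 0 = 1
  deg_zero : ∀ j, F.deg 0 j = 0
  homogeneous : ∀ i r c,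
    IsWeightedHomogeneous (fun j v => A v j) (F.d i r c) (F.deg (i + 1) c - F.deg i r)
  span_eq : Ideal.span {f | ∃ r c, f = F.d 0 r c} = toricIdeal K A
  exact : ∀ i, Function.Exact (F.d (i + 1)).mulVecLin (F.d i).mulVecLin
  minimal : ∀ i r c, constantCoeff (F.d i r c) = 0

/-- The projective dimension of `S/I` over the polynomial ring `S`. -/
noncomputable def pdQuotient {ι : Type} {K : Type*} [Field K] (I : Ideal (MvPolynomial ι K)) :
    WithBot ℕ∞ :=
  CategoryTheory.projectiveDimension (ModuleCat.of (MvPolynomial ι K) (MvPolynomial ι K ⧸ I))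

end ToricHypergraph

open ToricHypergraph

/-!
Everything follows from one fact about kernels and one about polynomial rings.

*Kernels.* Let `p` map an edge to the index of its block. The rows of the incidence matrix that carry
the block `Σ` differ from each other only in that block, so a vector of the kernel is constant on
blocks; on a vector `u ∘ p` the matrix acts like `E` does on `u`. Hence the kernel of the incidence
matrix is `{u ∘ p : u ∈ Ker E}`, and `Ker E = Ker D` because a toric ideal determines its lattice
(`isKernelLift_hMatrix`, `kerLattice_eq_of_toricIdeal_eq`). Since no column of `E` vanishes, every
block has at least two elements, and so distinct columns are distinct edges. That `E` exists is
Gordan's theorem: a positively graded matrix has a strictly positive vector in its row lattice, large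
multiples of which can be added to the rows. Graver bases, circuits, Gale vectors and stability only
depend on the lattice, and are compared along `u ↦ u ∘ p`.

*Polynomial rings.* Along `φ : x_i ↦ ∏_{p e = i} y_e` the ring `K[y]` is free over `K[x]`, with the
basis of those monomials `y^b` that no `φ(x_i)` divides. The coordinate functions `coordAt`, with
`φ(g)t ↦ g · coord(t)`, replace flatness and faithful flatness throughout: an element is in
`φ(I) K[y]` if and only if its coordinates are in `I` (`mem_map_liftHom_iff`), and a complex over
`K[x]` is exact if and only if its extension is (`exact_map_liftHom_iff`). As `I_H = φ(I_D) K[y]`,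
Markov bases correspond.

*Gröbner bases.* A monomial order of `K[y]` restricts to `K[x]`, and one of `K[x]` extends to `K[y]`.
For such a pair `φ` preserves and reflects reduced Gröbner bases, and reducedness forces every element
of a reduced Gröbner basis of `I_H` to be in the image of `φ`
(`OrdersCompatible.isReducedGroebnerBasis_image_iff`, `OrdersCompatible.exists_liftHom_eq`).

*Resolutions.* A minimal resolution of `K[x]/I_D` is built from minimal sets of homogeneous
generators; since only constants have degree `0`, their syzygies have no constant terms. The extension
of a minimal resolution along `φ` is minimal. Conversely, every minimal resolution of `K[y]/I_H` is an
extension: a homogeneous element whose degree is that of a lattice vector constant on blocks is in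
`φ(K[x])`, and all degrees of the resolution are of this kind (`IsKernelLift.exists_deg_eq`). Two
minimal resolutions are compared by chain maps that are inverse to each other modulo the variables,
which gives the Betti numbers; and the projective dimension is read off from the vanishing of the
ranks, because a projective syzygy module of a minimal resolution is free on the given basis
(`IsMinimalGradedFreeResolution.projective_syzygyModule_iff`).
-/

namespace ToricHypergraph

/-! ### Integer kernels, toric ideals and gradings -/

section Basics

variable {V ι : Type*} [Fintype ι]

theorem mem_kerLattice {A : Matrix V ι ℤ} {u : ι → ℤ} :
    u ∈ kerLattice A ↔ A.mulVec u = 0 := by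
  simp [kerLattice]

theorem weight_col_eq_mulVec (A : Matrix V ι ℤ) (c : ι →₀ ℕ) :
    Finsupp.weight (fun j v => A v j) c = A.mulVec (fun i => (c i : ℤ)) := by
  ext v
  rw [Finsupp.weight_apply, Finsupp.sum_fintype _ _ (by simp)]
  simp [Matrix.mulVec, dotProduct, mul_comm]

/-- The exponent vectors of two monomials of the same degree differ by a lattice vector. -/
theorem mulVec_eq_iff_sub_mem {A : Matrix V ι ℤ} {u v : ι → ℤ} :
    A.mulVec u = A.mulVec v ↔ u - v ∈ kerLattice A := by
  rw [mem_kerLattice, Matrix.mulVec_sub, sub_eq_zero]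

variable {K : Type*} [Field K]

/-- The homomorphism `x^c ↦ t^{Ac}` to the group algebra of `ℤ^V`, which kills `I_A`. -/
noncomputable def toGroupAlgebra (K : Type*) [Field K] (A : Matrix V ι ℤ) :
    MvPolynomial ι K →ₐ[K] AddMonoidAlgebra K (V → ℤ) :=
  aeval fun j => AddMonoidAlgebra.single (fun v => A v j) 1

theorem toGroupAlgebra_monomial (A : Matrix V ι ℤ) (c : ι →₀ ℕ) (a : K) :
    toGroupAlgebra K A (monomial c a) =
      AddMonoidAlgebra.single (A.mulVec fun i => (c i : ℤ)) a := by
  have h : (c.prod fun i k => (AddMonoidAlgebra.single (fun v => A v i) (1 : K)) ^ k)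
      = AddMonoidAlgebra.single (Finsupp.weight (fun j v => A v j) c) (1 : K) := by
    induction c using Finsupp.induction_linear with
    | zero => simp [AddMonoidAlgebra.one_def]
    | add f g hf hg =>
      rw [Finsupp.prod_add_index' (by simp) (by intros; rw [pow_add]), hf, hg, map_add,
        AddMonoidAlgebra.single_mul_single, mul_one]
    | single i k =>
      rw [Finsupp.prod_single_index (by simp), AddMonoidAlgebra.single_pow]
      simp [Finsupp.weight_single]
  rw [toGroupAlgebra, aeval_monomial, h, weight_col_eq_mulVec, Algebra.algebraMap_eq_smul_one,
    smul_mul_assoc, one_mul, AddMonoidAlgebra.smul_single, smul_eq_mul, mul_one]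

theorem mulVec_toNat_eq_iff {A : Matrix V ι ℤ} {u : ι → ℤ} :
    A.mulVec (fun i => ((u i).toNat : ℤ)) = A.mulVec (fun i => ((-u i).toNat : ℤ)) ↔
      u ∈ kerLattice A := by
  have h : (fun i => ((u i).toNat : ℤ)) - (fun i => ((-u i).toNat : ℤ)) = u := by
    ext i
    simp only [Pi.sub_apply]
    omega
  rw [mulVec_eq_iff_sub_mem, h]

theorem binomial_mem_toricIdeal_iff {A : Matrix V ι ℤ} {u : ι → ℤ} :
    binomial K u ∈ toricIdeal K A ↔ u ∈ kerLattice A := by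
  have key : ∀ u : ι → ℤ, toGroupAlgebra K A (binomial K u) = 0 ↔ u ∈ kerLattice A := by
    intro u
    rw [binomial, map_sub, toGroupAlgebra_monomial, toGroupAlgebra_monomial, sub_eq_zero]
    rw [(AddMonoidAlgebra.single_left_injective one_ne_zero).eq_iff]
    exact mulVec_toNat_eq_iff
  refine ⟨fun h => (key u).1 ?_, fun h => Ideal.subset_span ⟨u, h, rfl⟩⟩
  have hle : toricIdeal K A ≤ RingHom.ker (toGroupAlgebra K A) := by
    rw [toricIdeal, Ideal.span_le]
    rintro _ ⟨v, hv, rfl⟩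
    exact (key v).2 hv
  exact hle h

theorem kerLattice_eq_of_toricIdeal_eq {W : Type*} {A : Matrix V ι ℤ} {A' : Matrix W ι ℤ}
    (h : toricIdeal K A = toricIdeal K A') : kerLattice A = kerLattice A' := by
  ext u
  rw [← binomial_mem_toricIdeal_iff (K := K), h, binomial_mem_toricIdeal_iff]

theorem toricIdeal_eq_of_kerLattice_eq {W : Type*} {A : Matrix V ι ℤ} {A' : Matrix W ι ℤ}
    (h : kerLattice A = kerLattice A') : toricIdeal K A = toricIdeal K A' := by
  rw [toricIdeal, toricIdeal, h]

/-- In a positively graded ring only the constants have degree zero. -/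
theorem IsPositivelyGraded.eq_zero_of_mulVec {A : Matrix V ι ℤ} (hA : IsPositivelyGraded A)
    {c : ι →₀ ℕ} (h : A.mulVec (fun i => (c i : ℤ)) = 0) : c = 0 := by
  have := hA _ (mem_kerLattice.2 h) (fun i => by simp)
  ext i
  simpa using congrFun this i

theorem constantCoeff_binomial {A : Matrix V ι ℤ} (hA : IsPositivelyGraded A) {u : ι → ℤ}
    (hu : u ∈ kerLattice A) : constantCoeff (binomial K u) = 0 := by
  classical
  by_cases h0 : u = 0
  · simp [h0, binomial]
  have hne : ∀ v ∈ kerLattice A, v ≠ 0 →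
      (Finsupp.equivFunOnFinite.symm fun i => (v i).toNat) ≠ 0 := by
    intro v hv hv0 h
    refine hv0 (neg_eq_zero.1 (hA _ (neg_mem hv) fun i => ?_))
    have := DFunLike.congr_fun h i
    simp at this ⊢
    exact this
  have h1 := hne u hu h0
  have h2 := hne (-u) (neg_mem hu) (neg_ne_zero.2 h0)
  simp only [Pi.neg_apply] at h2
  rw [binomial, map_sub, constantCoeff_monomial, constantCoeff_monomial, if_neg h1, if_neg h2,
    sub_zero]

theorem constantCoeff_of_mem_toricIdeal {A : Matrix V ι ℤ} (hA : IsPositivelyGraded A)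
    {f : MvPolynomial ι K} (hf : f ∈ toricIdeal K A) : constantCoeff f = 0 := by
  have hle : toricIdeal K A ≤ RingHom.ker (constantCoeff (R := K) (σ := ι)) := by
    rw [toricIdeal, Ideal.span_le]
    rintro _ ⟨v, hv, rfl⟩
    exact constantCoeff_binomial hA hv
  exact hle hf

theorem isWeightedHomogeneous_binomial {A : Matrix V ι ℤ} {u : ι → ℤ} (hu : u ∈ kerLattice A) :
    ∃ h, IsWeightedHomogeneous (fun j v => A v j) (binomial K u) h := by
  refine ⟨_, (isWeightedHomogeneous_monomial _ _ _ rfl).sub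
    (isWeightedHomogeneous_monomial _ _ _ ?_)⟩
  rw [weight_col_eq_mulVec, weight_col_eq_mulVec]
  exact (mulVec_toNat_eq_iff.2 hu).symm

end Basics

/-! ### Gale transforms and stability -/

section Gale

variable {V ι : Type*} [Fintype ι]

theorem galeMultiple_iff {A : Matrix V ι ℤ} {i j : ι} {l : ℚ} :
    GaleMultiple A i j l ↔ ∀ u ∈ kerLattice A, (u i : ℚ) = l * u j := by
  constructor
  · intro h u hu
    have hsum : ∀ k, u k = ∑ t, (Module.finBasis ℤ (kerLattice A)).repr ⟨u, hu⟩ t * gale A k t := by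
      intro k
      have := congrArg (fun x : kerLattice A => (x : ι → ℤ) k)
        ((Module.finBasis ℤ (kerLattice A)).sum_repr ⟨u, hu⟩)
      simp only [Submodule.coe_sum, Finset.sum_apply, Submodule.coe_smul, Pi.smul_apply,
        smul_eq_mul] at this
      exact this.symm
    rw [hsum i, hsum j]
    push_cast
    rw [Finset.mul_sum]
    refine Finset.sum_congr rfl fun t _ => ?_
    rw [h t]
    ring
  · intro h k
    exact h _ (Module.finBasis ℤ (kerLattice A) k).2

theorem galeMultiple_zero_iff {A : Matrix V ι ℤ} {i : ι} :
    gale A i = 0 ↔ ∀ u ∈ kerLattice A, u i = 0 := by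
  have h0 : gale A i = 0 ↔ GaleMultiple A i i 0 := by
    simp [GaleMultiple, funext_iff]
  simp [h0, galeMultiple_iff]

/-- The Gale vectors of `i` and `j` are rational multiples of each other. -/
def GaleRel (A : Matrix V ι ℤ) (i j : ι) : Prop :=
  (∃ l, GaleMultiple A i j l) ∧ ∃ l, GaleMultiple A j i l

theorem galeMultiple_refl (A : Matrix V ι ℤ) (i : ι) : GaleMultiple A i i 1 := by
  simp [GaleMultiple]

theorem GaleMultiple.trans {A : Matrix V ι ℤ} {i j k : ι} {l l' : ℚ} (h : GaleMultiple A i j l)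
    (h' : GaleMultiple A j k l') : GaleMultiple A i k (l * l') := by
  intro t
  rw [h t, h' t, mul_assoc]

theorem galeRel_of_reachable {A : Matrix V ι ℤ} {i j : ι} (h : (bouquetGraph A).Reachable i j) :
    GaleRel A i j := by
  obtain ⟨w⟩ := h
  induction w with
  | nil => exact ⟨⟨1, galeMultiple_refl A _⟩, ⟨1, galeMultiple_refl A _⟩⟩
  | cons hadj _ ih =>
    obtain ⟨-, ⟨l, hl⟩, l', hl'⟩ := hadj
    obtain ⟨⟨r, hr⟩, r', hr'⟩ := ih
    exact ⟨⟨_, hl.trans hr⟩, ⟨_, hr'.trans hl'⟩⟩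

/-- Stability in terms of the kernel lattice alone: the choice of the Gale transform is
irrelevant. -/
theorem isStable_iff {A : Matrix V ι ℤ} :
    IsStable A ↔ ∀ i j, GaleRel A i j → gale A i ≠ 0 → ∃ l : ℚ, 0 < l ∧ GaleMultiple A i j l := by
  constructor
  · intro h i j hij hi
    by_cases hne : i = j
    · subst hne
      exact ⟨1, one_pos, galeMultiple_refl A i⟩
    have hadj : (bouquetGraph A).Adj i j := ⟨hne, hij⟩
    have hmem : i ∈ ((bouquetGraph A).connectedComponentMk i).supp := rfl
    have hmem' : j ∈ ((bouquetGraph A).connectedComponentMk i).supp :=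
      SimpleGraph.ConnectedComponent.sound hadj.symm.reachable
    have hfree : ¬ IsFree A ((bouquetGraph A).connectedComponentMk i).supp :=
      fun hf => hi (hf i hmem)
    exact (h _ ⟨_, rfl⟩ hfree).2 i hmem j hmem' hadj
  · rintro h _ ⟨C, rfl⟩ hfree
    refine ⟨hfree, fun i hi j hj hadj => h i j hadj.2 fun hi0 => hfree fun k hk => ?_⟩
    have hr : (bouquetGraph A).Reachable k i :=
      SimpleGraph.ConnectedComponent.exact (hk.trans hi.symm)
    obtain ⟨⟨l, hl⟩, -⟩ := galeRel_of_reachable hr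
    ext t
    have := hl t
    rw [hi0] at this
    simpa using this

end Gale

/-! ### A natural number matrix with the same kernel -/

theorem exists_forall_lt_mul {n : ℕ} (a : Fin n → ℚ) {b : Fin n → ℚ} (hb : ∀ i, 0 < b i) :
    ∃ t, ∀ i, a i < t * b i := by
  refine ⟨1 + ∑ j, |a j| / b j, fun i => ?_⟩
  have hle : |a i| / b i ≤ ∑ j, |a j| / b j :=
    Finset.single_le_sum (f := fun j => |a j| / b j)
      (fun j _ => div_nonneg (abs_nonneg _) (hb j).le) (Finset.mem_univ i)
  have h1 := mul_le_mul_of_nonneg_right hle (hb i).le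
  rw [div_mul_cancel₀ _ (hb i).ne'] at h1
  have h2 := le_abs_self (a i)
  have h3 := hb i
  rw [add_mul]
  linarith

/-- Gordan's theorem of the alternative: vectors without a nontrivial nonnegative relation lie in an
open half-space. Induction on the number of vectors: if modulo the line of the first vector `v`
there is still no relation, a functional on the quotient is perturbed to be positive on `v`;
otherwise `v` is in the cone of the others, where any functional positive on those is positive. -/
theorem exists_dual_pos_of_forall_nonneg_relation (n : ℕ) :
    ∀ {V : Type} [AddCommGroup V] [Module ℚ V] (d : Fin n → V),
      (∀ c : Fin n → ℚ, 0 ≤ c → ∑ i, c i • d i = 0 → c = 0) →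
      ∃ f : V →ₗ[ℚ] ℚ, ∀ i, 0 < f (d i) := by
  induction n with
  | zero => exact fun _ _ => ⟨0, fun i => i.elim0⟩
  | succ n ih =>
    intro V _ _ d hd
    have hcons : ∀ (a : ℚ) (c : Fin n → ℚ), 0 ≤ a → 0 ≤ c →
        a • d 0 + ∑ i, c i • d i.succ = 0 → a = 0 ∧ c = 0 := by
      intro a c ha hc h
      have h0 := hd (Fin.cons a c) (fun i => by
        refine Fin.cases ?_ (fun j => ?_) i
        · simpa using ha
        · simpa using hc j) (by simpa [Fin.sum_univ_succ] using h)
      exact ⟨by simpa using congrFun h0 0, funext fun j => by simpa using congrFun h0 j.succ⟩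
    by_cases hrel : ∃ c : Fin n → ℚ, 0 ≤ c ∧ c ≠ 0 ∧ ∃ a : ℚ, ∑ i, c i • d i.succ = a • d 0
    · obtain ⟨c, hc, hc0, a, hca⟩ := hrel
      obtain ⟨f, hf⟩ := ih (fun i => d i.succ) fun c hc h =>
        (hcons 0 c le_rfl hc (by simpa using h)).2
      have ha : 0 < a := by
        by_contra hna
        exact hc0 (hcons (-a) c (by linarith) hc (by rw [hca]; simp)).2
      refine ⟨f, fun i => Fin.cases ?_ hf i⟩
      have hsum : ∑ i, c i * f (d i.succ) = a * f (d 0) := by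
        simpa using congrArg f hca
      obtain ⟨i, hi⟩ := Function.ne_iff.1 hc0
      have hpos : 0 < ∑ i, c i * f (d i.succ) :=
        Finset.sum_pos' (fun i _ => mul_nonneg (hc i) (hf i).le)
          ⟨i, Finset.mem_univ i, mul_pos (lt_of_le_of_ne (hc i) (Ne.symm hi)) (hf i)⟩
      rw [hsum] at hpos
      exact (mul_pos_iff_of_pos_left ha).1 hpos
    · have hv : d 0 ≠ 0 := fun h => by
        have := (hcons 1 0 (by norm_num) le_rfl (by simp [h])).1
        norm_num at this
      obtain ⟨h, hh⟩ := Module.Projective.exists_dual_eq_one ℚ hv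
      obtain ⟨g, hg⟩ := ih (fun i => (Submodule.span ℚ {d 0}).mkQ (d i.succ)) fun c hc hsum => by
        by_contra hc0
        refine hrel ⟨c, hc, hc0, ?_⟩
        have h1 : (Submodule.span ℚ {d 0}).mkQ (∑ i, c i • d i.succ) = 0 := by
          simpa using hsum
        rw [Submodule.mkQ_apply, Submodule.Quotient.mk_eq_zero,
          Submodule.mem_span_singleton] at h1
        obtain ⟨a, ha⟩ := h1
        exact ⟨a, ha.symm⟩
      have hq : (Submodule.span ℚ {d 0}).mkQ (d 0) = 0 := by
        rw [Submodule.mkQ_apply, Submodule.Quotient.mk_eq_zero]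
        exact Submodule.mem_span_singleton_self _
      obtain ⟨t, ht⟩ := exists_forall_lt_mul (fun i : Fin n => -h (d i.succ)) hg
      refine ⟨t • (g ∘ₗ (Submodule.span ℚ {d 0}).mkQ) + h, fun i => ?_⟩
      refine Fin.cases ?_ (fun i => ?_) i
      · simp only [LinearMap.add_apply, LinearMap.smul_apply, LinearMap.comp_apply, hq, map_zero,
          smul_zero, hh]
        norm_num
      · have := ht i
        simp only [LinearMap.add_apply, LinearMap.smul_apply, LinearMap.comp_apply, smul_eq_mul]
        linarith

/-- A positively graded matrix has a strictly positive vector in its row lattice. -/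
theorem exists_vecMul_pos {m n : ℕ} {D : Matrix (Fin m) (Fin n) ℤ} (hpos : IsPositivelyGraded D) :
    ∃ y : Fin m → ℤ, ∀ i, 0 < Matrix.vecMul y D i := by
  classical
  obtain ⟨f, hf⟩ := exists_dual_pos_of_forall_nonneg_relation n
    (fun i (k : Fin m) => (D k i : ℚ)) (fun c hc h => by
      -- clear the denominators of the relation
      obtain ⟨b, hb⟩ := IsLocalization.exist_integer_multiples_of_finite (nonZeroDivisors ℤ) c
      choose z hz using hb
      have hb0 : (b : ℤ) ≠ 0 := nonZeroDivisors.coe_ne_zero b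
      have hz' : ∀ i, (z i : ℚ) = (b : ℤ) * c i := fun i => by simpa using hz i
      have hsq : (fun i => (b : ℤ) * z i) ∈ kerLattice D := by
        rw [mem_kerLattice]
        ext k
        have hk := congrFun h k
        simp only [Finset.sum_apply, Pi.smul_apply, smul_eq_mul, Pi.zero_apply] at hk
        have : ((∑ i, D k i * ((b : ℤ) * z i) : ℤ) : ℚ) = 0 := by
          push_cast
          calc ∑ i, (D k i : ℚ) * (((b : ℤ) : ℚ) * (z i : ℚ))
              = ∑ i, (((b : ℤ) : ℚ) * ((b : ℤ) : ℚ)) * (c i * D k i) :=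
                Finset.sum_congr rfl fun i _ => by rw [hz' i]; ring
            _ = 0 := by rw [← Finset.mul_sum, hk, mul_zero]
        simpa [Matrix.mulVec, dotProduct] using (by exact_mod_cast this : _ = (0 : ℤ))
      have h0 := hpos _ hsq (fun i => by
        have : (0 : ℚ) ≤ (((b : ℤ) * z i : ℤ) : ℚ) := by
          push_cast
          rw [hz' i, ← mul_assoc]
          exact mul_nonneg (mul_self_nonneg _) (hc i)
        exact_mod_cast this)
      ext i
      have h1 : (b : ℤ) * z i = 0 := congrFun h0 i
      have h2 : z i = 0 := (mul_eq_zero.1 h1).resolve_left hb0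
      have h3 := hz' i
      rw [h2] at h3
      have hb0' : ((b : ℤ) : ℚ) ≠ 0 := by exact_mod_cast hb0
      simpa [hb0'] using h3.symm)
  obtain ⟨b, hb⟩ := IsLocalization.exist_integer_multiples_of_finite (nonZeroDivisors ℤ)
    (fun k => f (Pi.single k 1))
  choose z hz using hb
  have hb0 : (b : ℤ) ≠ 0 := nonZeroDivisors.coe_ne_zero b
  have hz' : ∀ k, (z k : ℚ) = (b : ℤ) * f (Pi.single k 1) := fun i => by simpa using hz i
  refine ⟨fun k => (b : ℤ) * z k, fun i => ?_⟩
  have hfi : f (fun k => (D k i : ℚ)) = ∑ k, (D k i : ℚ) * f (Pi.single k 1) := by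
    conv_lhs => rw [pi_eq_sum_univ' (fun k => (D k i : ℚ))]
    simp [map_sum, map_smul]
  have hq : (0 : ℚ) < ((∑ k, ((b : ℤ) * z k) * D k i : ℤ) : ℚ) := by
    push_cast
    calc (0 : ℚ) < (((b : ℤ) : ℚ) * ((b : ℤ) : ℚ)) * f (fun k => (D k i : ℚ)) :=
          mul_pos (mul_self_pos.2 (by exact_mod_cast hb0)) (hf i)
      _ = _ := by
          rw [hfi, Finset.mul_sum]
          exact Finset.sum_congr rfl fun k _ => by rw [hz' k]; ring
  have hi : (0 : ℤ) < ∑ k, ((b : ℤ) * z k) * D k i := by exact_mod_cast hq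
  simpa [Matrix.vecMul, dotProduct] using hi

/-- Adding a large multiple of a strictly positive combination `w` of the rows to every row, and `w`
itself as a further row, does not change the kernel. -/
theorem exists_nat_matrix_kerLattice_eq {m n : ℕ} {D : Matrix (Fin m) (Fin n) ℤ}
    (hpos : IsPositivelyGraded D) :
    ∃ E : Matrix (Fin (m + 1)) (Fin n) ℕ,
      kerLattice (E.map (Nat.cast : ℕ → ℤ)) = kerLattice D := by
  obtain ⟨y, hy⟩ := exists_vecMul_pos hpos
  set w := Matrix.vecMul y D with hw
  set N : ℤ := ∑ k, ∑ i, |D k i| with hN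
  have hbound : ∀ k i, 0 ≤ D k i + N * w i := by
    intro k i
    have h1 : |D k i| ≤ N :=
      (Finset.single_le_sum (f := fun i => |D k i|) (fun _ _ => abs_nonneg _)
        (Finset.mem_univ i)).trans
      (Finset.single_le_sum (f := fun k => ∑ i, |D k i|)
        (fun _ _ => Finset.sum_nonneg fun _ _ => abs_nonneg _) (Finset.mem_univ k))
    have h2 := neg_abs_le (D k i)
    have h3 := hy i
    have h4 := abs_nonneg (D k i)
    nlinarith
  obtain ⟨E, h0, hs⟩ : ∃ E : Matrix (Fin (m + 1)) (Fin n) ℕ,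
      (∀ i, (E 0 i : ℤ) = w i) ∧ ∀ k i, (E (Fin.succ k) i : ℤ) = D k i + N * w i :=
    ⟨Matrix.of (Fin.cons (fun i => (w i).toNat) fun k i => (D k i + N * w i).toNat),
      fun i => by simpa using (hy i).le, fun k i => by simpa using hbound k i⟩
  refine ⟨E, ?_⟩
  ext u
  rw [mem_kerLattice, mem_kerLattice]
  have hwu : D.mulVec u = 0 → ∑ i, w i * u i = 0 := fun h => by
    have := Matrix.dotProduct_mulVec y D u
    rw [h, dotProduct_zero] at this
    exact this.symm
  have hrow : ∀ k, ∑ i, (D k i + N * w i) * u i = D.mulVec u k + N * ∑ i, w i * u i := by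
    intro k
    simp only [Matrix.mulVec, dotProduct, Finset.mul_sum, ← Finset.sum_add_distrib]
    exact Finset.sum_congr rfl fun i _ => by ring
  constructor
  · intro h
    have h1 : ∑ i, w i * u i = 0 := by
      have := congrFun h 0
      simpa only [Matrix.mulVec, dotProduct, Matrix.map_apply, h0, Pi.zero_apply] using this
    ext k
    have := congrFun h k.succ
    simp only [Matrix.mulVec, dotProduct, Matrix.map_apply, hs] at this
    rw [hrow k, h1] at this
    simpa using this
  · intro h
    ext k
    refine Fin.cases ?_ (fun k => ?_) k
    · simp only [Matrix.mulVec, dotProduct, Matrix.map_apply, h0]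
      exact hwu h
    · simp only [Matrix.mulVec, dotProduct, Matrix.map_apply, hs]
      rw [hrow k, hwu h, h]
      simp

/-! ### The polynomial ring in blocks of variables as a free module -/

section Lift

set_option linter.unusedSectionVars false

variable {σ τ : Type*} [Fintype σ] [Fintype τ]

/-- The exponent vector of the image of `x^u` under `x_i ↦ ∏_{p e = i} y_e`. -/
noncomputable def pullExp (p : τ → σ) : (σ →₀ ℕ) →+ (τ →₀ ℕ) where
  toFun u := Finsupp.equivFunOnFinite.symm fun e => u (p e)
  map_zero' := by ext; simp
  map_add' u v := by ext; simp

/-- The largest `u` such that the image of `x^u` divides `y^c`: its coordinates are the minima of `c`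
over the fibres of `p`. -/
noncomputable def core (p : τ → σ) (c : τ →₀ ℕ) : σ →₀ ℕ :=
  Finsupp.equivFunOnFinite.symm fun i => sInf (c '' (p ⁻¹' {i}))

/-- The exponent vector of the cofactor of the image of `x^u`, `u = core p c`, in `y^c`. -/
noncomputable def remainder (p : τ → σ) (c : τ →₀ ℕ) : τ →₀ ℕ :=
  c - pullExp p (core p c)

@[simp]
theorem pullExp_apply (p : τ → σ) (u : σ →₀ ℕ) (e : τ) : pullExp p u e = u (p e) := rfl

theorem core_le (p : τ → σ) (c : τ →₀ ℕ) (e : τ) : core p c (p e) ≤ c e :=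
  Nat.sInf_le ⟨e, rfl, rfl⟩

theorem exists_core_eq {p : τ → σ} (hp : Function.Surjective p) (c : τ →₀ ℕ) (i : σ) :
    ∃ e, p e = i ∧ c e = core p c i := by
  obtain ⟨e₀, he₀⟩ := hp i
  obtain ⟨e, he, h⟩ := Nat.sInf_mem (s := c '' (p ⁻¹' {i})) ⟨_, e₀, he₀, rfl⟩
  exact ⟨e, he, h⟩

theorem core_pullExp_add {p : τ → σ} (hp : Function.Surjective p) (a : σ →₀ ℕ) (c : τ →₀ ℕ) :
    core p (pullExp p a + c) = a + core p c := by
  ext i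
  apply le_antisymm
  · obtain ⟨e, rfl, he⟩ := exists_core_eq hp c i
    simpa [he] using core_le p (pullExp p a + c) e
  · obtain ⟨e, rfl, he⟩ := exists_core_eq hp (pullExp p a + c) i
    rw [← he]
    simpa using core_le p c e

theorem pullExp_core_add_remainder (p : τ → σ) (c : τ →₀ ℕ) :
    pullExp p (core p c) + remainder p c = c := by
  ext e
  have := core_le p c e
  simp only [remainder, Finsupp.coe_add, Finsupp.coe_tsub, Pi.add_apply, Pi.sub_apply,
    pullExp_apply]
  omega

theorem remainder_pullExp_add {p : τ → σ} (hp : Function.Surjective p) (a : σ →₀ ℕ)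
    (c : τ →₀ ℕ) : remainder p (pullExp p a + c) = remainder p c := by
  rw [remainder, core_pullExp_add hp, map_add, add_tsub_add_eq_tsub_left, remainder]

theorem core_zero {p : τ → σ} (hp : Function.Surjective p) : core p 0 = 0 := by
  ext i
  obtain ⟨e, -, he⟩ := exists_core_eq hp 0 i
  exact he.symm

theorem core_pullExp {p : τ → σ} (hp : Function.Surjective p) (a : σ →₀ ℕ) :
    core p (pullExp p a) = a := by
  simpa [core_zero hp] using core_pullExp_add hp a 0

theorem remainder_zero (p : τ → σ) : remainder p 0 = 0 := by
  simp [remainder]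

theorem remainder_pullExp {p : τ → σ} (hp : Function.Surjective p) (a : σ →₀ ℕ) :
    remainder p (pullExp p a) = 0 := by
  simpa [remainder_zero] using remainder_pullExp_add hp a 0

theorem core_remainder {p : τ → σ} (hp : Function.Surjective p) (c : τ →₀ ℕ) :
    core p (remainder p c) = 0 := by
  have h := core_pullExp_add hp (core p c) (remainder p c)
  rw [pullExp_core_add_remainder] at h
  exact left_eq_add.1 h

theorem pullExp_le_pullExp {p : τ → σ} (hp : Function.Surjective p) {a b : σ →₀ ℕ} :
    pullExp p a ≤ pullExp p b ↔ a ≤ b := by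
  constructor
  · intro h i
    obtain ⟨e, rfl⟩ := hp i
    exact h e
  · exact fun h e => h (p e)

theorem pullExp_injective {p : τ → σ} (hp : Function.Surjective p) :
    Function.Injective (pullExp p) := fun _ _ h =>
  le_antisymm ((pullExp_le_pullExp hp).1 h.le) ((pullExp_le_pullExp hp).1 h.ge)

/-- Divisibility by a monomial of the subring only depends on the core. -/
theorem pullExp_le_iff {p : τ → σ} (hp : Function.Surjective p) {a : σ →₀ ℕ} {c : τ →₀ ℕ} :
    pullExp p a ≤ c ↔ a ≤ core p c := by
  constructor
  · intro h i
    obtain ⟨e, rfl, he⟩ := exists_core_eq hp c i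
    exact (h e).trans he.le
  · exact fun h e => (h (p e)).trans (core_le p c e)

variable [DecidableEq σ] (K : Type*) [Field K]

/-- The homomorphism that sends `x_i` to the product of the `y_e` with `p e = i`. -/
noncomputable def liftHom (p : τ → σ) : MvPolynomial σ K →ₐ[K] MvPolynomial τ K :=
  aeval fun i => ∏ e with p e = i, X e

theorem liftHom_monomial (p : τ → σ) (u : σ →₀ ℕ) (a : K) :
    liftHom K p (monomial u a) = monomial (pullExp p u) a := by
  rw [liftHom, aeval_monomial, monomial_eq, algebraMap_eq,
    Finsupp.prod_fintype _ _ (by simp), Finsupp.prod_fintype _ _ (by simp)]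
  congr 1
  rw [← Finset.prod_fiberwise (s := Finset.univ) (g := p)]
  refine Finset.prod_congr rfl fun i _ => ?_
  rw [← Finset.prod_pow]
  exact Finset.prod_congr rfl fun e he => by rw [pullExp_apply, (Finset.mem_filter.1 he).2]

open Classical in
/-- The monomials `y^b` which are not divisible by the image of any `x_i` form a basis of the ring
`K[y]` over `K[x]`; this is the coordinate function of `y^b`. -/
noncomputable def coordAt (p : τ → σ) (b : τ →₀ ℕ) : MvPolynomial τ K →ₗ[K] MvPolynomial σ K :=
  (basisMonomials τ K).constr K fun c => if remainder p c = b then monomial (core p c) 1 else 0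

open Classical in
theorem coordAt_monomial (p : τ → σ) (b c : τ →₀ ℕ) (a : K) :
    coordAt K p b (monomial c a) = if remainder p c = b then monomial (core p c) a else 0 := by
  have h : (monomial c a : MvPolynomial τ K) = a • basisMonomials τ K c := by
    simp [smul_monomial]
  rw [h, map_smul, coordAt, Module.Basis.constr_basis, smul_ite, smul_zero, smul_monomial, smul_eq_mul,
    mul_one]

variable {K}

/-- The coordinate functions are linear over `K[x]`. -/
theorem coordAt_liftHom_mul {p : τ → σ} (hp : Function.Surjective p) (b : τ →₀ ℕ)
    (g : MvPolynomial σ K) (t : MvPolynomial τ K) :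
    coordAt K p b (liftHom K p g * t) = g * coordAt K p b t := by
  classical
  induction g using MvPolynomial.induction_on' with
  | add f g hf hg => simp only [add_mul, map_add, hf, hg]
  | monomial u a =>
    induction t using MvPolynomial.induction_on' with
    | monomial c k =>
      rw [liftHom_monomial, monomial_mul, coordAt_monomial, coordAt_monomial,
        remainder_pullExp_add hp, core_pullExp_add hp, mul_ite, mul_zero, monomial_mul]
    | add f g hf hg => simp only [mul_add, map_add, hf, hg]

theorem coordAt_liftHom {p : τ → σ} (hp : Function.Surjective p) (b : τ →₀ ℕ)
    (g : MvPolynomial σ K) [Decidable (b = 0)] :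
    coordAt K p b (liftHom K p g) = if b = 0 then g else 0 := by
  classical
  have h := coordAt_liftHom_mul hp b g 1
  rw [mul_one] at h
  rw [h, ← C_1, C_apply, coordAt_monomial, remainder_zero, core_zero hp]
  by_cases hb : b = 0
  · simp [hb]
  · rw [if_neg (Ne.symm hb), if_neg hb, mul_zero]

theorem liftHom_injective {p : τ → σ} (hp : Function.Surjective p) :
    Function.Injective (liftHom K p) := by
  classical
  intro f g h
  simpa [coordAt_liftHom hp] using congrArg (coordAt K p 0) h

theorem coeff_coordAt {p : τ → σ} (hp : Function.Surjective p) {b : τ →₀ ℕ}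
    (hb : core p b = 0) (f : MvPolynomial τ K) (v : σ →₀ ℕ) :
    coeff v (coordAt K p b f) = coeff (pullExp p v + b) f := by
  classical
  induction f using MvPolynomial.induction_on' with
  | add f g hf hg => simp only [map_add, coeff_add, hf, hg]
  | monomial c k =>
    rw [coordAt_monomial, coeff_monomial]
    by_cases hc : c = pullExp p v + b
    · subst hc
      rw [remainder_pullExp_add hp, core_pullExp_add hp, hb, add_zero]
      have : remainder p b = b := by rw [remainder, hb, map_zero, tsub_zero]
      simp [this]
    · rw [if_neg hc]
      split_ifs with h
      · rw [coeff_monomial, if_neg]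
        rintro rfl
        exact hc (by rw [← h, pullExp_core_add_remainder])
      · simp

/-- Every polynomial is the combination of the `y^b` with its coordinates. -/
theorem sum_liftHom_coordAt (p : τ → σ) (f : MvPolynomial τ K) {s : Finset (τ →₀ ℕ)}
    (hs : ∀ c ∈ f.support, remainder p c ∈ s) :
    ∑ b ∈ s, liftHom K p (coordAt K p b f) * monomial b 1 = f := by
  classical
  have h : ∀ c ∈ f.support, ∑ b ∈ s, liftHom K p (coordAt K p b (monomial c (coeff c f))) *
      monomial b 1 = monomial c (coeff c f) := by
    intro c hc
    rw [Finset.sum_eq_single (remainder p c)]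
    · rw [coordAt_monomial, if_pos rfl, liftHom_monomial, monomial_mul, mul_one,
        pullExp_core_add_remainder]
    · intro b _ hb
      rw [coordAt_monomial, if_neg (Ne.symm hb), map_zero, zero_mul]
    · exact fun h => absurd (hs c hc) h
  have key : ∑ b ∈ s, liftHom K p (coordAt K p b (∑ c ∈ f.support, monomial c (coeff c f))) *
      monomial b 1 = ∑ c ∈ f.support, monomial c (coeff c f) := by
    simp only [map_sum, Finset.sum_mul]
    rw [Finset.sum_comm]
    exact Finset.sum_congr rfl h
  rwa [support_sum_monomial_coeff] at key

theorem exists_forall_sum_liftHom_coordAt {α : Type*} [Finite α] (p : τ → σ)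
    (y : α → MvPolynomial τ K) : ∃ s : Finset (τ →₀ ℕ), 0 ∈ s ∧
      ∀ a, ∑ b ∈ s, liftHom K p (coordAt K p b (y a)) * monomial b 1 = y a := by
  classical
  cases nonempty_fintype α
  exact ⟨insert 0 (Finset.univ.biUnion fun a => (y a).support.image (remainder p)),
    Finset.mem_insert_self _ _, fun a => sum_liftHom_coordAt p _ fun c hc =>
      Finset.mem_insert_of_mem (Finset.mem_biUnion.2
        ⟨a, Finset.mem_univ a, Finset.mem_image_of_mem _ hc⟩)⟩

theorem mem_map_liftHom_iff {p : τ → σ} (hp : Function.Surjective p)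
    {I : Ideal (MvPolynomial σ K)} {f : MvPolynomial τ K} :
    f ∈ I.map (liftHom K p) ↔ ∀ b, coordAt K p b f ∈ I := by
  constructor
  · intro hf b
    induction hf using Submodule.closure_induction with
    | zero => simp
    | add x y _ _ hx hy => rw [map_add]; exact I.add_mem hx hy
    | smul_mem a x hx =>
      obtain ⟨g, hg, rfl⟩ := hx
      rw [smul_eq_mul, mul_comm]
      change coordAt K p b (liftHom K p g * a) ∈ I
      rw [coordAt_liftHom_mul hp]
      exact I.mul_mem_right _ hg
  · intro h
    rw [← sum_liftHom_coordAt p f (s := f.support.image (remainder p))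
      fun c hc => Finset.mem_image_of_mem _ hc]
    exact sum_mem fun b _ => Ideal.mul_mem_right _ _ (Ideal.mem_map_of_mem _ (h b))

theorem liftHom_mem_map_iff {p : τ → σ} (hp : Function.Surjective p)
    {I : Ideal (MvPolynomial σ K)} {f : MvPolynomial σ K} :
    liftHom K p f ∈ I.map (liftHom K p) ↔ f ∈ I := by
  classical
  refine ⟨fun h => ?_, fun h => Ideal.mem_map_of_mem _ h⟩
  simpa [coordAt_liftHom hp] using (mem_map_liftHom_iff hp).1 h 0

theorem map_liftHom_injective {p : τ → σ} (hp : Function.Surjective p) :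
    Function.Injective (Ideal.map (liftHom K p)) := by
  intro I J h
  ext f
  rw [← liftHom_mem_map_iff hp, h, liftHom_mem_map_iff hp]

theorem constantCoeff_liftHom {p : τ → σ} (hp : Function.Surjective p) (f : MvPolynomial σ K) :
    constantCoeff (liftHom K p f) = constantCoeff f := by
  classical
  have := coeff_coordAt (K := K) hp (core_zero hp) (liftHom K p f) 0
  rw [coordAt_liftHom hp, if_pos rfl, map_zero, zero_add] at this
  exact this.symm

theorem coordAt_map_mulVec {p : τ → σ} (hp : Function.Surjective p) {α β : Type*} [Fintype β]
    (M : Matrix α β (MvPolynomial σ K)) (y : β → MvPolynomial τ K) (b : τ →₀ ℕ) (a : α) :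
    coordAt K p b ((M.map (liftHom K p)).mulVec y a) =
      M.mulVec (fun j => coordAt K p b (y j)) a := by
  simp [Matrix.mulVec, dotProduct, coordAt_liftHom_mul hp]

theorem map_liftHom_mulVec (p : τ → σ) {α β : Type*} [Fintype β]
    (M : Matrix α β (MvPolynomial σ K)) (x : β → MvPolynomial σ K) (a : α) :
    (M.map (liftHom K p)).mulVec (fun j => liftHom K p (x j)) a =
      liftHom K p (M.mulVec x a) := by
  simp [Matrix.mulVec, dotProduct]

theorem liftHom_binomial (p : τ → σ) (u : σ → ℤ) :
    liftHom K p (binomial K u) = binomial K (fun e => u (p e)) := by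
  rw [binomial, map_sub, liftHom_monomial, liftHom_monomial]
  rfl

end Lift

/-! ### Lattice vectors constant on blocks: Graver bases, circuits and Markov bases -/

section Lattice

set_option linter.unusedSectionVars false

variable {σ τ V W : Type*} [Fintype σ] [Fintype τ]

/-- The kernel of `A'` consists of the vectors that are constant on the fibres of `p`, with values a
vector of the kernel of `A`. -/
def IsKernelLift (p : τ → σ) (A : Matrix V σ ℤ) (A' : Matrix W τ ℤ) : Prop :=
  (kerLattice A' : Set (τ → ℤ)) = (fun u => u ∘ p) '' (kerLattice A : Set (σ → ℤ))

variable {p : τ → σ} {A : Matrix V σ ℤ} {A' : Matrix W τ ℤ}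

theorem IsKernelLift.exists_of_mem (h : IsKernelLift p A A') {w : τ → ℤ} (hw : w ∈ kerLattice A') :
    ∃ u ∈ kerLattice A, u ∘ p = w := by
  have : w ∈ (kerLattice A' : Set (τ → ℤ)) := hw
  rwa [h] at this

theorem IsKernelLift.comp_mem_iff (h : IsKernelLift p A A') (hp : Function.Surjective p)
    {u : σ → ℤ} : u ∘ p ∈ kerLattice A' ↔ u ∈ kerLattice A := by
  have h1 : u ∘ p ∈ (kerLattice A' : Set (τ → ℤ)) ↔ u ∈ kerLattice A := by
    rw [h]
    exact hp.injective_comp_right.mem_set_image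
  exact h1

theorem IsKernelLift.isPositivelyGraded (h : IsKernelLift p A A') (hp : Function.Surjective p)
    (hA : IsPositivelyGraded A) : IsPositivelyGraded A' := by
  intro w hw hw0
  obtain ⟨u, hu, rfl⟩ := h.exists_of_mem hw
  rw [hA u hu fun i => by obtain ⟨e, rfl⟩ := hp i; exact hw0 e]
  rfl

theorem IsKernelLift.bijOn (h : IsKernelLift p A A') (hp : Function.Surjective p)
    {P : Set (σ → ℤ)} {P' : Set (τ → ℤ)} (hP' : P' ⊆ kerLattice A')
    (hiff : ∀ u ∈ kerLattice A, u ∘ p ∈ P' ↔ u ∈ P) (hP : P ⊆ kerLattice A) :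
    Set.BijOn (fun u => u ∘ p) P P' := by
  refine ⟨fun u hu => (hiff u (hP hu)).2 hu, hp.injective_comp_right.injOn, fun w hw => ?_⟩
  obtain ⟨u, hu, rfl⟩ := h.exists_of_mem (hP' hw)
  exact ⟨u, (hiff u hu).1 hw, rfl⟩

theorem comp_eq_zero_iff (hp : Function.Surjective p) {u : σ → ℤ} : u ∘ p = 0 ↔ u = 0 := by
  rw [← hp.injective_comp_right.eq_iff]
  rfl

theorem IsKernelLift.bijOn_graverBasis (h : IsKernelLift p A A') (hp : Function.Surjective p) :
    Set.BijOn (fun u => u ∘ p) (graverBasis A) (graverBasis A') := by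
  refine h.bijOn hp (fun _ hw => hw.1) (fun u _ => ?_) fun _ hu => hu.1
  have hadd : ∀ a b c : σ → ℤ, a ∘ p = b ∘ p + c ∘ p ↔ a = b + c := fun a b c =>
    hp.injective_comp_right.eq_iff (a := a) (b := b + c)
  refine and_congr (h.comp_mem_iff hp) (and_congr (comp_eq_zero_iff hp).not ?_)
  constructor
  · intro hmin v hv w hw h1 h2
    have := hmin _ ((h.comp_mem_iff hp).2 hv) _ ((h.comp_mem_iff hp).2 hw)
      ((hadd _ _ _).2 h1) ((hadd _ _ _).2 h2)
    rwa [comp_eq_zero_iff hp, comp_eq_zero_iff hp] at this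
  · intro hmin v' hv' w' hw' h1 h2
    obtain ⟨v, hv, rfl⟩ := h.exists_of_mem hv'
    obtain ⟨w, hw, rfl⟩ := h.exists_of_mem hw'
    rw [comp_eq_zero_iff hp, comp_eq_zero_iff hp]
    exact hmin v hv w hw ((hadd _ _ _).1 h1) ((hadd _ _ _).1 h2)

theorem IsKernelLift.bijOn_circuits (h : IsKernelLift p A A') (hp : Function.Surjective p) :
    Set.BijOn (fun u => u ∘ p) (circuits A) (circuits A') := by
  classical
  refine h.bijOn hp (fun _ hw => hw.1) (fun u _ => ?_) fun _ hu => hu.1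
  have hgcd : Finset.univ.gcd (u ∘ p) = Finset.univ.gcd u := by
    rw [← Finset.gcd_image, Finset.image_univ_of_surjective hp]
  have hsupp : ∀ v : σ → ℤ, Function.support (v ∘ p) = p ⁻¹' Function.support v := fun v => rfl
  refine and_congr (h.comp_mem_iff hp) (and_congr (comp_eq_zero_iff hp).not
    (and_congr (by rw [hgcd]) ?_))
  constructor
  · intro hmin v hv hv0 hsub
    have := hmin _ ((h.comp_mem_iff hp).2 hv) ((comp_eq_zero_iff hp).not.2 hv0)
      (by rw [hsupp, hsupp]; exact Set.preimage_mono hsub)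
    rw [hsupp, hsupp] at this
    exact hp.preimage_injective this
  · intro hmin v' hv' hv0 hsub
    obtain ⟨v, hv, rfl⟩ := h.exists_of_mem hv'
    rw [hsupp, hsupp, hp.preimage_subset_preimage_iff] at hsub
    rw [hsupp, hsupp, hmin v hv ((comp_eq_zero_iff hp).not.1 hv0) hsub]

variable {K : Type*} [Field K] [DecidableEq σ]

theorem IsKernelLift.toricIdeal_eq_map (h : IsKernelLift p A A') :
    toricIdeal K A' = (toricIdeal K A).map (liftHom K p) := by
  rw [toricIdeal, toricIdeal, Ideal.map_span, h, Set.image_image, Set.image_image]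
  congr 1
  exact Set.image_congr fun u _ => (liftHom_binomial p u).symm

theorem IsKernelLift.isMarkovBasis_image_iff (h : IsKernelLift p A A')
    (hp : Function.Surjective p) {M : Set (σ → ℤ)} :
    IsMarkovBasis K A' ((fun u => u ∘ p) '' M) ↔ IsMarkovBasis K A M := by
  refine and_congr (Set.finite_image_iff hp.injective_comp_right.injOn) (and_congr ?_ ?_)
  · rw [h, Set.image_subset_image_iff hp.injective_comp_right]
  · rw [h.toricIdeal_eq_map, ← (map_liftHom_injective (K := K) hp).eq_iff, Ideal.map_span,
      Set.image_image, Set.image_image]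
    simp only [liftHom_binomial]
    rfl

theorem IsKernelLift.isMinimalMarkovBasis_image_iff (h : IsKernelLift p A A')
    (hp : Function.Surjective p) {M : Set (σ → ℤ)} :
    IsMinimalMarkovBasis K A' ((fun u => u ∘ p) '' M) ↔ IsMinimalMarkovBasis K A M := by
  refine and_congr (h.isMarkovBasis_image_iff hp) ?_
  have hss : ∀ N : Set (σ → ℤ), (fun u => u ∘ p) '' N ⊂ (fun u => u ∘ p) '' M ↔ N ⊂ M := fun N =>
    and_congr (Set.image_subset_image_iff hp.injective_comp_right)
      (not_congr (Set.image_subset_image_iff hp.injective_comp_right))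
  constructor
  · intro hmin N hN hmark
    exact hmin _ ((hss N).2 hN)
      ((h.isMarkovBasis_image_iff hp).2 hmark)
  · intro hmin N' hN' hmark
    obtain ⟨N, rfl⟩ : ∃ N, (fun u => u ∘ p) '' N = N' :=
      Set.subset_range_iff_exists_image_eq.1
        (hN'.1.trans (Set.image_subset_range _ _))
    exact hmin N ((hss N).1 hN')
      ((h.isMarkovBasis_image_iff hp).1 hmark)

theorem IsKernelLift.exists_image_eq (h : IsKernelLift p A A') {M' : Set (τ → ℤ)}
    (hM' : M' ⊆ kerLattice A') : ∃ M, (fun u : σ → ℤ => u ∘ p) '' M = M' := by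
  refine Set.subset_range_iff_exists_image_eq.1 fun w hw => ?_
  obtain ⟨u, -, rfl⟩ := h.exists_of_mem (hM' hw)
  exact ⟨u, rfl⟩

theorem IsKernelLift.bijOn_minimalMarkovBases (h : IsKernelLift p A A')
    (hp : Function.Surjective p) :
    Set.BijOn (fun M => (fun u => u ∘ p) '' M)
      {M | IsMinimalMarkovBasis K A M} {M | IsMinimalMarkovBasis K A' M} := by
  refine ⟨fun M hM => (h.isMinimalMarkovBasis_image_iff hp).2 hM,
    (hp.injective_comp_right.image_injective).injOn, fun M' hM' => ?_⟩
  obtain ⟨M, rfl⟩ := h.exists_image_eq hM'.1.2.1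
  exact ⟨M, (h.isMinimalMarkovBasis_image_iff hp).1 hM', rfl⟩

theorem IsKernelLift.bijOn_indispensables (h : IsKernelLift p A A')
    (hp : Function.Surjective p) :
    Set.BijOn (fun u => u ∘ p) (indispensables K A) (indispensables K A') := by
  refine h.bijOn hp (fun _ hw => hw.1) (fun u _ => ?_) fun _ hu => hu.1
  have hmem : ∀ (v : σ → ℤ) (M : Set (σ → ℤ)), v ∘ p ∈ (fun u => u ∘ p) '' M ↔ v ∈ M :=
    fun v M => hp.injective_comp_right.mem_set_image
  refine and_congr (h.comp_mem_iff hp) ⟨fun hall M hM => ?_, fun hall M' hM' => ?_⟩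
  · exact (hall _ ((h.isMinimalMarkovBasis_image_iff hp).2 hM)).imp (hmem u M).1 (hmem (-u) M).1
  · obtain ⟨M, rfl⟩ := h.exists_image_eq hM'.1.2.1
    exact (hall _ ((h.isMinimalMarkovBasis_image_iff hp).1 hM')).imp (hmem u M).2 (hmem (-u) M).2

theorem IsKernelLift.galeMultiple_iff (h : IsKernelLift p A A') (hp : Function.Surjective p)
    {e f : τ} {l : ℚ} : GaleMultiple A' e f l ↔ GaleMultiple A (p e) (p f) l := by
  rw [ToricHypergraph.galeMultiple_iff, ToricHypergraph.galeMultiple_iff]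
  constructor
  · exact fun hm u hu => hm _ ((h.comp_mem_iff hp).2 hu)
  · intro hm w hw
    obtain ⟨u, hu, rfl⟩ := h.exists_of_mem hw
    exact hm u hu

theorem IsKernelLift.gale_eq_zero_iff (h : IsKernelLift p A A') (hp : Function.Surjective p)
    {e : τ} : gale A' e = 0 ↔ gale A (p e) = 0 := by
  rw [galeMultiple_zero_iff, galeMultiple_zero_iff]
  constructor
  · exact fun hm u hu => hm _ ((h.comp_mem_iff hp).2 hu)
  · intro hm w hw
    obtain ⟨u, hu, rfl⟩ := h.exists_of_mem hw
    exact hm u hu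

theorem IsKernelLift.isStable_iff (h : IsKernelLift p A A') (hp : Function.Surjective p) :
    IsStable A' ↔ IsStable A := by
  simp only [ToricHypergraph.isStable_iff, GaleRel, h.galeMultiple_iff hp, ne_eq,
    h.gale_eq_zero_iff hp]
  constructor
  · intro hs i j
    obtain ⟨e, rfl⟩ := hp i
    obtain ⟨f, rfl⟩ := hp j
    exact hs e f
  · exact fun hs e f => hs (p e) (p f)

end Lattice

/-! ### Reduced Gröbner bases -/

section Groebner

set_option linter.unusedSectionVars false

variable {σ τ : Type*} [Fintype σ] [Fintype τ]

/-- An injective homomorphism as an isomorphism to its range. -/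
noncomputable def rangeEquivOfInjective {M α : Type*} [AddCommMonoid M] [AddCommMonoid α]
    (g : M →+ α) (hinj : Function.Injective g) : M ≃+ AddMonoidHom.mrange g :=
  AddEquiv.ofBijective g.mrangeRestrict
    ⟨fun _ _ h => hinj (congrArg Subtype.val h), g.mrangeRestrict_surjective⟩

/-- The monomial order given by an injective monotone homomorphism to a well-ordered cancellative
monoid. -/
noncomputable def monomialOrderOfHom {α : Type*} [AddCommMonoid α] [LinearOrder α]
    [IsOrderedAddMonoid α] [WellFoundedLT α] (g : (σ →₀ ℕ) →+ α) (hinj : Function.Injective g)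
    (hmono : Monotone g) : MonomialOrder σ where
  syn := AddMonoidHom.mrange g
  toSyn := rangeEquivOfInjective g hinj
  toSyn_monotone := fun _ _ h => hmono h

theorem monomialOrderOfHom_le_iff {α : Type*} [AddCommMonoid α] [LinearOrder α]
    [IsOrderedAddMonoid α] [WellFoundedLT α] (g : (σ →₀ ℕ) →+ α) (hinj : Function.Injective g)
    (hmono : Monotone g) {a b : σ →₀ ℕ} :
    (monomialOrderOfHom g hinj hmono).toSyn a ≤ (monomialOrderOfHom g hinj hmono).toSyn b ↔
      g a ≤ g b := Iff.rfl

/-- The monomial order `mo'` of `K[y]` induces the order `mo` on the subring `K[x]`. -/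
def OrdersCompatible (p : τ → σ) (mo : MonomialOrder σ) (mo' : MonomialOrder τ) : Prop :=
  ∀ a b, mo'.toSyn (pullExp p a) ≤ mo'.toSyn (pullExp p b) ↔ mo.toSyn a ≤ mo.toSyn b

theorem exists_restricted_order {p : τ → σ} (hp : Function.Surjective p)
    (mo' : MonomialOrder.{_, 0} τ) : ∃ mo : MonomialOrder.{_, 0} σ, OrdersCompatible p mo mo' := by
  refine ⟨monomialOrderOfHom ((mo'.toSyn : (τ →₀ ℕ) →+ mo'.syn).comp (pullExp p))
    (mo'.toSyn.injective.comp (pullExp_injective hp))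
    (mo'.toSyn_monotone.comp fun a b h => (pullExp_le_pullExp hp).2 h), fun a b => Iff.rfl⟩

/-- A monomial order of `K[x]` extends to `K[y]`: compare the exponents of one variable in each block
first, and break ties lexicographically. -/
theorem exists_extended_order {τ : Type} [Fintype τ] [LinearOrder τ] {p : τ → σ}
    (hp : Function.Surjective p) (mo : MonomialOrder.{_, 0} σ) :
    ∃ mo' : MonomialOrder.{_, 0} τ, OrdersCompatible p mo mo' := by
  obtain ⟨s, hs⟩ := hp.hasRightInverse
  let g : (τ →₀ ℕ) →+ Lex (mo.syn × (MonomialOrder.lex (σ := τ)).syn) :=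
    { toFun := fun c => toLex (mo.toSyn (pullExp s c), MonomialOrder.lex.toSyn c)
      map_zero' := by simp
      map_add' := fun a b => by simp [← toLex_add] }
  have hinj : Function.Injective g := fun a b h =>
    MonomialOrder.lex.toSyn.injective (congrArg (fun x => (ofLex x).2) h)
  have hmono : Monotone g := fun a b h =>
    Prod.Lex.toLex_mono ⟨mo.toSyn_monotone fun i => h (s i), MonomialOrder.lex.toSyn_monotone h⟩
  refine ⟨monomialOrderOfHom g hinj hmono, fun a b => ?_⟩
  rw [monomialOrderOfHom_le_iff]
  have hsec : ∀ a, pullExp s (pullExp p a) = a := fun a => by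
    ext i
    simp [hs i]
  constructor
  · intro h
    have h1 : mo.toSyn (pullExp s (pullExp p a)) ≤ mo.toSyn (pullExp s (pullExp p b)) :=
      Prod.Lex.monotone_fst _ _ h
    rwa [hsec, hsec] at h1
  · intro h
    change toLex _ ≤ toLex _
    rw [Prod.Lex.toLex_le_toLex, hsec, hsec]
    rcases h.lt_or_eq with h | h
    · exact Or.inl h
    · refine Or.inr ⟨h, ?_⟩
      rw [mo.toSyn.injective h]

variable {K : Type*} [Field K]

theorem degree_eq_of_forall_le {mo : MonomialOrder σ} {f : MvPolynomial σ K} {d : σ →₀ ℕ}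
    (hd : d ∈ f.support) (h : ∀ c ∈ f.support, mo.toSyn c ≤ mo.toSyn d) : mo.degree f = d := by
  have hf : f ≠ 0 := by
    rintro rfl
    simp at hd
  exact mo.toSyn.injective (le_antisymm (h _ (mo.degree_mem_support hf)) (mo.le_degree hd))

variable [DecidableEq σ] {p : τ → σ}

theorem mem_support_liftHom_iff (hp : Function.Surjective p) {g : MvPolynomial σ K} {c : τ →₀ ℕ} :
    c ∈ (liftHom K p g).support ↔ ∃ v ∈ g.support, pullExp p v = c := by
  classical
  have h := coeff_coordAt (K := K) hp (core_remainder hp c) (liftHom K p g) (core p c)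
  rw [pullExp_core_add_remainder, coordAt_liftHom hp] at h
  rw [mem_support_iff, ← h]
  constructor
  · intro h1
    split_ifs at h1 with h0
    · refine ⟨core p c, mem_support_iff.2 h1, ?_⟩
      simpa [h0] using pullExp_core_add_remainder p c
    · simp at h1
  · rintro ⟨v, hv, rfl⟩
    rw [remainder_pullExp hp, if_pos rfl, core_pullExp hp]
    exact mem_support_iff.1 hv

theorem coeff_pullExp_liftHom (hp : Function.Surjective p) (g : MvPolynomial σ K) (v : σ →₀ ℕ) :
    coeff (pullExp p v) (liftHom K p g) = coeff v g := by
  classical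
  have h := coeff_coordAt (K := K) hp (core_zero hp) (liftHom K p g) v
  rw [add_zero, coordAt_liftHom hp, if_pos rfl] at h
  exact h.symm

variable {mo : MonomialOrder σ} {mo' : MonomialOrder τ}

theorem OrdersCompatible.degree_liftHom (h : OrdersCompatible p mo mo')
    (hp : Function.Surjective p) (g : MvPolynomial σ K) :
    mo'.degree (liftHom K p g) = pullExp p (mo.degree g) := by
  by_cases hg : g = 0
  · simp [hg]
  · refine degree_eq_of_forall_le
      ((mem_support_liftHom_iff hp).2 ⟨_, mo.degree_mem_support hg, rfl⟩) fun c hc => ?_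
    obtain ⟨v, hv, rfl⟩ := (mem_support_liftHom_iff hp).1 hc
    exact (h _ _).2 (mo.le_degree hv)

theorem OrdersCompatible.leadingCoeff_liftHom (h : OrdersCompatible p mo mo')
    (hp : Function.Surjective p) (g : MvPolynomial σ K) :
    mo'.leadingCoeff (liftHom K p g) = mo.leadingCoeff g := by
  rw [MonomialOrder.leadingCoeff, h.degree_liftHom hp, coeff_pullExp_liftHom hp,
    MonomialOrder.leadingCoeff]

/-- The coordinate of `f` that contains the leading monomial of `f`. -/
theorem OrdersCompatible.degree_coordAt (h : OrdersCompatible p mo mo')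
    (hp : Function.Surjective p) {f : MvPolynomial τ K} (hf : f ≠ 0) :
    coordAt K p (remainder p (mo'.degree f)) f ≠ 0 ∧
      mo.degree (coordAt K p (remainder p (mo'.degree f)) f) = core p (mo'.degree f) ∧
      mo.leadingCoeff (coordAt K p (remainder p (mo'.degree f)) f) = mo'.leadingCoeff f := by
  set d := mo'.degree f with hd
  have hcoeff := coeff_coordAt (K := K) hp (core_remainder hp d) f
  have hlc : coeff (core p d) (coordAt K p (remainder p d) f) = mo'.leadingCoeff f := by
    rw [hcoeff, pullExp_core_add_remainder]
    rfl
  have hmem : core p d ∈ (coordAt K p (remainder p d) f).support := by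
    rw [mem_support_iff, hlc]
    exact mo'.leadingCoeff_ne_zero_iff.2 hf
  have hdeg : mo.degree (coordAt K p (remainder p d) f) = core p d := by
    refine degree_eq_of_forall_le hmem fun v hv => ?_
    rw [mem_support_iff, hcoeff] at hv
    have hle := mo'.le_degree (mem_support_iff.2 hv)
    have hle' : mo'.toSyn (pullExp p v + remainder p d) ≤
        mo'.toSyn (pullExp p (core p d) + remainder p d) := by
      rw [pullExp_core_add_remainder]
      exact hle
    rw [map_add, map_add] at hle'
    exact (h _ _).1 (le_of_add_le_add_right hle')
  refine ⟨fun h0 => ?_, hdeg, ?_⟩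
  · rw [h0] at hmem
    simp at hmem
  · rw [MonomialOrder.leadingCoeff, hdeg, hlc]

theorem OrdersCompatible.isReducedGroebnerBasis_image_iff (h : OrdersCompatible p mo mo')
    (hp : Function.Surjective p) {I : Ideal (MvPolynomial σ K)} {G : Set (MvPolynomial σ K)} :
    IsReducedGroebnerBasis mo' (I.map (liftHom K p)) (liftHom K p '' G) ↔
      IsReducedGroebnerBasis mo I G := by
  simp only [IsReducedGroebnerBasis, Set.forall_mem_image, Set.exists_mem_image,
    h.degree_liftHom hp, h.leadingCoeff_liftHom hp]
  refine and_congr ?_ (and_congr ?_ (and_congr Iff.rfl ?_))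
  · rw [Set.image_subset_iff]
    exact forall₂_congr fun g _ => liftHom_mem_map_iff hp
  · constructor
    · intro hG f hf hf0
      obtain ⟨g, hg, hle⟩ := hG _ ((liftHom_mem_map_iff hp).2 hf)
        ((map_ne_zero_iff _ (liftHom_injective hp)).2 hf0)
      rw [h.degree_liftHom hp, pullExp_le_pullExp hp] at hle
      exact ⟨g, hg, hle⟩
    · intro hG f hf hf0
      obtain ⟨h0, hdeg, -⟩ := h.degree_coordAt hp hf0
      obtain ⟨g, hg, hle⟩ := hG _ ((mem_map_liftHom_iff hp).1 hf _) h0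
      rw [hdeg] at hle
      exact ⟨g, hg, (pullExp_le_iff hp).2 hle⟩
  · refine forall₄_congr fun g _ k _ => ?_
    rw [ne_eq, (liftHom_injective hp).eq_iff]
    refine imp_congr_right fun _ => ⟨fun hs s hsg => ?_, fun hs c hc => ?_⟩
    · have := hs _ ((mem_support_liftHom_iff hp).2 ⟨s, hsg, rfl⟩)
      rwa [pullExp_le_pullExp hp] at this
    · obtain ⟨s, hsg, rfl⟩ := (mem_support_liftHom_iff hp).1 hc
      rw [pullExp_le_pullExp hp]
      exact hs s hsg

/-- The elements of a reduced Gröbner basis of an extended ideal come from the subring: the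
coordinate of `g` with the leading monomial is in the ideal, so by reducedness the leading monomial
of `g` is in the subring; and the difference of `g` and its coordinate at `1` is in the ideal, but has
no leading monomial that the basis could divide without violating reducedness. -/
theorem OrdersCompatible.exists_liftHom_eq (h : OrdersCompatible p mo mo')
    (hp : Function.Surjective p) {I : Ideal (MvPolynomial σ K)} {G : Set (MvPolynomial τ K)}
    (hG : IsReducedGroebnerBasis mo' (I.map (liftHom K p)) G) {g : MvPolynomial τ K} (hg : g ∈ G) :
    liftHom K p (coordAt K p 0 g) = g := by
  classical
  obtain ⟨hsub, hlead, hmonic, hred⟩ := hG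
  have hg0 : g ≠ 0 := by
    rintro rfl
    simpa using hmonic _ hg
  obtain ⟨h0, hdeg, -⟩ := h.degree_coordAt hp hg0
  have hrem : remainder p (mo'.degree g) = 0 := by
    obtain ⟨k, hk, hle⟩ := hlead _ (Ideal.mem_map_of_mem (liftHom K p)
      ((mem_map_liftHom_iff hp).1 (hsub hg) (remainder p (mo'.degree g))))
      ((map_ne_zero_iff _ (liftHom_injective hp)).2 h0)
    rw [h.degree_liftHom hp, hdeg] at hle
    have hle' : pullExp p (core p (mo'.degree g)) ≤ mo'.degree g := (pullExp_le_iff hp).2 le_rfl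
    have hkg : k = g := by
      by_contra hne
      exact hred g hg k hk hne _ (mo'.degree_mem_support hg0) (hle.trans hle')
    rw [hkg] at hle
    rw [remainder, le_antisymm hle' hle, tsub_self]
  by_contra hne
  have hdiff : g - liftHom K p (coordAt K p 0 g) ≠ 0 := fun h => hne (sub_eq_zero.1 h).symm
  have hcoeff : ∀ c, coeff c (liftHom K p (coordAt K p 0 g)) =
      if remainder p c = 0 then coeff c g else 0 := by
    intro c
    have h1 := coeff_coordAt (K := K) hp (core_remainder hp c)
      (liftHom K p (coordAt K p 0 g)) (core p c)
    rw [pullExp_core_add_remainder, coordAt_liftHom hp] at h1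
    rw [← h1]
    split_ifs with hc
    · rw [coeff_coordAt hp (core_zero hp), ← hc, pullExp_core_add_remainder]
    · simp
  obtain ⟨k, hk, hle⟩ := hlead _ (Ideal.sub_mem _ (hsub hg) (Ideal.mem_map_of_mem (liftHom K p)
    ((mem_map_liftHom_iff hp).1 (hsub hg) 0))) hdiff
  have hmem := mo'.degree_mem_support hdiff
  set d := mo'.degree (g - liftHom K p (coordAt K p 0 g)) with hd
  rw [mem_support_iff, coeff_sub, hcoeff] at hmem
  have hdrem : remainder p d ≠ 0 := fun h => hmem (by rw [if_pos h, sub_self])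
  rw [if_neg hdrem, sub_zero] at hmem
  have hkg : k = g := by
    by_contra hne
    exact hred g hg k hk hne d (mem_support_iff.2 hmem) hle
  rw [hkg] at hle
  have heq : mo'.degree g = d := mo'.toSyn.injective
    (le_antisymm (mo'.toSyn_monotone hle) (mo'.le_degree (mem_support_iff.2 hmem)))
  exact hdrem (heq ▸ hrem)

theorem bijOn_reducedGroebnerBases {τ : Type} [Fintype τ] [LinearOrder τ] {p : τ → σ}
    (hp : Function.Surjective p) (I : Ideal (MvPolynomial σ K)) :
    Set.BijOn (fun G => liftHom K p '' G) (reducedGroebnerBases I)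
      (reducedGroebnerBases (I.map (liftHom K p))) := by
  refine ⟨?_, (liftHom_injective hp).image_injective.injOn, ?_⟩
  · rintro G ⟨mo, hG⟩
    obtain ⟨mo', h⟩ := exists_extended_order hp mo
    exact ⟨mo', (h.isReducedGroebnerBasis_image_iff hp).2 hG⟩
  · rintro G' ⟨mo', hG'⟩
    obtain ⟨mo, h⟩ := exists_restricted_order hp mo'
    have himage : liftHom K p '' (coordAt K p 0 '' G') = G' := by
      rw [Set.image_image]
      ext g
      constructor
      · rintro ⟨k, hk, rfl⟩
        change liftHom K p (coordAt K p 0 k) ∈ G'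
        rw [h.exists_liftHom_eq hp hG' hk]
        exact hk
      · exact fun hg => ⟨g, hg, h.exists_liftHom_eq hp hG' hg⟩
    refine ⟨_, ⟨mo, ?_⟩, himage⟩
    rw [← h.isReducedGroebnerBasis_image_iff hp, himage]
    exact hG'

end Groebner

/-! ### Homogeneous vectors -/

section Homogeneous

variable {ι K M : Type*} [Field K] [AddCommGroup M] {w : ι → M}

theorem weightedHomogeneousComponent_mul_of_left {f : MvPolynomial ι K} {a : M}
    (hf : IsWeightedHomogeneous w f a) (g : MvPolynomial ι K) (h : M) :
    weightedHomogeneousComponent w h (f * g) = f * weightedHomogeneousComponent w (h - a) g := by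
  classical
  induction g using MvPolynomial.induction_on' with
  | add p q hp hq => rw [mul_add, map_add, hp, hq, map_add, mul_add]
  | monomial u k =>
    have hm : IsWeightedHomogeneous w (monomial u k) (Finsupp.weight w u) :=
      isWeightedHomogeneous_monomial _ _ _ rfl
    by_cases hu : h - a = Finsupp.weight w u
    · rw [hu, hm.weightedHomogeneousComponent_same, (by rw [← hu]; abel : h = a + Finsupp.weight w u),
        (hf.mul hm).weightedHomogeneousComponent_same]
    · rw [hm.weightedHomogeneousComponent_ne _ hu, mul_zero,
        (hf.mul hm).weightedHomogeneousComponent_ne]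
      rintro rfl
      exact hu (by abel)

/-- The vector `x` is homogeneous of degree `h` in the free module with basis degrees `a`. -/
def IsHomogeneousVec {r : ℕ} (w : ι → M) (a : Fin r → M) (h : M) (x : Fin r → MvPolynomial ι K) :
    Prop :=
  ∀ k, IsWeightedHomogeneous w (x k) (h - a k)

/-- The matrix `d` is homogeneous of degree `0`, the basis degrees being `b` and `a`. -/
def IsHomogeneousMatrix {r q : ℕ} (w : ι → M) (a : Fin r → M) (b : Fin q → M)
    (d : Matrix (Fin r) (Fin q) (MvPolynomial ι K)) : Prop :=
  ∀ k c, IsWeightedHomogeneous w (d k c) (b c - a k)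

/-- The homogeneous component of degree `h` of a vector, the basis degrees being `a`. -/
noncomputable def vecComponent {r : ℕ} (w : ι → M) (a : Fin r → M) (h : M)
    (x : Fin r → MvPolynomial ι K) : Fin r → MvPolynomial ι K :=
  fun k => weightedHomogeneousComponent w (h - a k) (x k)

variable {r q s : ℕ} {a : Fin r → M} {b : Fin q → M}

theorem isHomogeneousVec_vecComponent (h : M) (x : Fin r → MvPolynomial ι K) :
    IsHomogeneousVec w a h (vecComponent w a h x) := fun _ =>
  weightedHomogeneousComponent_isWeightedHomogeneous _ _

theorem IsHomogeneousVec.vecComponent_eq {h : M} {x : Fin r → MvPolynomial ι K}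
    (hx : IsHomogeneousVec w a h x) : vecComponent w a h x = x :=
  funext fun k => (hx k).weightedHomogeneousComponent_same

theorem IsHomogeneousMatrix.vecComponent_mulVec {d : Matrix (Fin r) (Fin q) (MvPolynomial ι K)}
    (hd : IsHomogeneousMatrix w a b d) (h : M) (x : Fin q → MvPolynomial ι K) :
    vecComponent w a h (d.mulVec x) = d.mulVec (vecComponent w b h x) := by
  ext1 k
  simp only [vecComponent, Matrix.mulVec, dotProduct, map_sum]
  refine Finset.sum_congr rfl fun c _ => ?_
  rw [weightedHomogeneousComponent_mul_of_left (hd k c)]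
  congr 2
  abel_nf

theorem exists_sum_vecComponent_eq (w : ι → M) (a : Fin r → M) (x : Fin r → MvPolynomial ι K) :
    ∃ t : Finset M, ∑ h ∈ t, vecComponent w a h x = x := by
  classical
  refine ⟨Finset.univ.biUnion fun k => (x k).support.image fun c => Finsupp.weight w c + a k, ?_⟩
  ext1 k
  ext c
  simp only [Finset.sum_apply, vecComponent, coeff_sum, coeff_weightedHomogeneousComponent]
  by_cases hc : coeff c (x k) = 0
  · simp [hc]
  · rw [Finset.sum_eq_single (Finsupp.weight w c + a k)]
    · simp
    · intro h _ hne
      rw [if_neg]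
      intro heq
      exact hne (by rw [heq, sub_add_cancel])
    · intro hn
      exact absurd (Finset.mem_biUnion.2 ⟨k, Finset.mem_univ k,
        Finset.mem_image_of_mem _ (mem_support_iff.2 hc)⟩) hn

/-- A homogeneous vector in the image of a homogeneous matrix has a homogeneous preimage. -/
theorem IsHomogeneousMatrix.exists_isHomogeneousVec
    {d : Matrix (Fin r) (Fin q) (MvPolynomial ι K)} (hd : IsHomogeneousMatrix w a b d) {h : M}
    {x : Fin r → MvPolynomial ι K} (hx : IsHomogeneousVec w a h x)
    (hmem : x ∈ LinearMap.range d.mulVecLin) :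
    ∃ y, IsHomogeneousVec w b h y ∧ d.mulVec y = x := by
  obtain ⟨y, rfl⟩ := hmem
  refine ⟨vecComponent w b h y, isHomogeneousVec_vecComponent h y, ?_⟩
  rw [← hd.vecComponent_mulVec]
  exact hx.vecComponent_eq

theorem IsHomogeneousMatrix.mul {c : Fin s → M} {d : Matrix (Fin r) (Fin q) (MvPolynomial ι K)}
    {d' : Matrix (Fin q) (Fin s) (MvPolynomial ι K)} (hd : IsHomogeneousMatrix w a b d)
    (hd' : IsHomogeneousMatrix w b c d') : IsHomogeneousMatrix w a c (d * d') := by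
  intro i j
  rw [Matrix.mul_apply]
  refine IsWeightedHomogeneous.sum _ _ _ fun k _ => ?_
  have := (hd i k).mul (hd' k j)
  rwa [add_comm, sub_add_sub_cancel] at this

/-- The submodule `Z` is generated by its homogeneous elements. -/
def IsHomogeneousSubmodule (w : ι → M) (a : Fin r → M)
    (Z : Submodule (MvPolynomial ι K) (Fin r → MvPolynomial ι K)) : Prop :=
  Submodule.span _ {x | x ∈ Z ∧ ∃ h, IsHomogeneousVec w a h x} = Z

theorem IsHomogeneousMatrix.isHomogeneousSubmodule_ker
    {d : Matrix (Fin r) (Fin q) (MvPolynomial ι K)} (hd : IsHomogeneousMatrix w a b d) :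
    IsHomogeneousSubmodule w b (LinearMap.ker d.mulVecLin) := by
  refine le_antisymm (Submodule.span_le.2 fun x hx => hx.1) fun x hx => ?_
  obtain ⟨t, ht⟩ := exists_sum_vecComponent_eq w b x
  rw [← ht]
  refine sum_mem fun h _ => Submodule.subset_span ⟨?_, h, isHomogeneousVec_vecComponent h x⟩
  rw [LinearMap.mem_ker, Matrix.mulVecLin_apply] at hx ⊢
  rw [← hd.vecComponent_mulVec, hx]
  ext1 k
  simp [vecComponent]

end Homogeneous

/-! ### Existence of minimal graded free resolutions -/

section Existence

variable {V ι K : Type*} [Fintype ι] [Field K] {A : Matrix V ι ℤ}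

theorem weightedHomogeneousComponent_zero_eq_C (hA : IsPositivelyGraded A)
    (f : MvPolynomial ι K) :
    weightedHomogeneousComponent (fun j v => A v j) 0 f = C (constantCoeff f) := by
  classical
  ext c
  rw [coeff_weightedHomogeneousComponent, coeff_C, weight_col_eq_mulVec]
  by_cases hc : c = 0
  · subst hc
    have : A.mulVec (fun i => (((0 : ι →₀ ℕ) i : ℕ) : ℤ)) = 0 := by
      convert Matrix.mulVec_zero A
      simp
    rw [if_pos this, if_pos rfl]
    rfl
  · rw [if_neg (fun h => hc (hA.eq_zero_of_mulVec h)), if_neg (Ne.symm hc)]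

/-- A homogeneous submodule of a free module has a homogeneous generating set all of whose
syzygies have entries without constant term: a generating set with the smallest number of elements,
since a constant term in a syzygy makes a generator redundant. -/
theorem exists_minimal_generators (hA : IsPositivelyGraded A) {r : ℕ} {a : Fin r → V → ℤ}
    {Z : Submodule (MvPolynomial ι K) (Fin r → MvPolynomial ι K)}
    (hZ : IsHomogeneousSubmodule (fun j v => A v j) a Z) :
    ∃ (q : ℕ) (b : Fin q → V → ℤ) (d : Matrix (Fin r) (Fin q) (MvPolynomial ι K)),
      IsHomogeneousMatrix (fun j v => A v j) a b d ∧ LinearMap.range d.mulVecLin = Z ∧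
      ∀ y, d.mulVec y = 0 → ∀ j, constantCoeff (y j) = 0 := by
  classical
  have hex : ∃ q, ∃ g : Fin q → Fin r → MvPolynomial ι K,
      (∀ j, ∃ h, IsHomogeneousVec (fun j v => A v j) a h (g j)) ∧
      Submodule.span (MvPolynomial ι K) (Set.range g) = Z := by
    have hfg : (Submodule.span (MvPolynomial ι K)
        {x | x ∈ Z ∧ ∃ h, IsHomogeneousVec (fun j v => A v j) a h x}).FG :=
      IsNoetherian.noetherian _
    obtain ⟨t, ht, hspan⟩ := Submodule.fg_span_iff_fg_span_finset_subset _ |>.1 hfg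
    refine ⟨t.card, fun j => t.equivFin.symm j, fun j => (ht (t.equivFin.symm j).2).2, ?_⟩
    have hrange : Set.range (fun j => (t.equivFin.symm j : Fin r → MvPolynomial ι K)) = t := by
      ext x
      constructor
      · rintro ⟨j, rfl⟩
        exact (t.equivFin.symm j).2
      · exact fun hx => ⟨t.equivFin ⟨x, hx⟩, by simp⟩
    rw [hrange, ← hspan]
    exact hZ
  obtain ⟨g, hg, hspan⟩ := Nat.find_spec hex
  have hmin := fun m (hm : m < Nat.find hex) => Nat.find_min hex hm
  generalize Nat.find hex = q at g hg hspan hmin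
  choose b hb using hg
  have hd : IsHomogeneousMatrix (fun j v => A v j) a b (Matrix.of fun k j => g j k) :=
    fun k j => hb j k
  refine ⟨q, b, Matrix.of fun k j => g j k, hd, ?_, fun y hy j => ?_⟩
  · rw [Matrix.range_mulVecLin, ← hspan]
    rfl
  · by_contra hne
    obtain _ | q := q
    · exact j.elim0
    set y' := vecComponent (fun j v => A v j) b (b j) y with hy'
    have hy0 : (Matrix.of fun k j => g j k).mulVec y' = 0 := by
      rw [hy', ← hd.vecComponent_mulVec, hy]
      ext1 k
      simp [vecComponent]
    have hyj : y' j = C (constantCoeff (y j)) := by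
      rw [← weightedHomogeneousComponent_zero_eq_C hA, hy', vecComponent, sub_self]
    have hsum : ∑ i, y' i • g i = 0 := by
      ext1 k
      have := congrFun hy0 k
      simpa [Matrix.mulVec, dotProduct, mul_comm] using this
    rw [Fin.sum_univ_succAbove _ j, hyj] at hsum
    refine hmin q (Nat.lt_succ_self q) ⟨fun i => g (j.succAbove i), fun i => ⟨_, hb _⟩, ?_⟩
    rw [← hspan]
    refine le_antisymm (Submodule.span_mono (Set.range_comp_subset_range j.succAbove g))
      (Submodule.span_le.2 ?_)
    rintro _ ⟨i, rfl⟩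
    have hmem : ∀ i, g (j.succAbove i) ∈ Submodule.span (MvPolynomial ι K)
        (Set.range fun i => g (j.succAbove i)) := fun i => Submodule.subset_span ⟨i, rfl⟩
    rcases Fin.eq_self_or_eq_succAbove j i with rfl | ⟨i, rfl⟩
    · have hgi : g i = (C (constantCoeff (y i))⁻¹ : MvPolynomial ι K) •
          -∑ k, y' (i.succAbove k) • g (i.succAbove k) := by
        rw [← eq_neg_of_add_eq_zero_left hsum, smul_smul, ← C_mul, inv_mul_cancel₀ hne, C_1,
          one_smul]
      rw [SetLike.mem_coe, hgi]
      exact Submodule.smul_mem _ _ (neg_mem (sum_mem fun k _ => Submodule.smul_mem _ _ (hmem k)))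
    · exact hmem i

/-- The image of `F_1 → F_0 = S` is `I` exactly when the entries of the matrix generate `I`. -/
theorem span_entries_eq_iff {R : Type*} [CommRing R] {r q : ℕ} (hr : r = 1)
    (d : Matrix (Fin r) (Fin q) R) (I : Ideal R) :
    Ideal.span {f | ∃ k c, f = d k c} = I ↔
      LinearMap.range d.mulVecLin = Submodule.pi Set.univ fun _ => I := by
  subst hr
  have hspan : Ideal.span {f | ∃ k c, f = d k c} = Ideal.span (Set.range (d 0)) := by
    congr 1
    ext f
    constructor
    · rintro ⟨k, c, rfl⟩
      rw [Subsingleton.elim k 0]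
      exact ⟨c, rfl⟩
    · rintro ⟨c, rfl⟩
      exact ⟨0, c, rfl⟩
  have hmem : ∀ x : Fin 1 → R, x ∈ LinearMap.range d.mulVecLin ↔
      x 0 ∈ Ideal.span {f | ∃ k c, f = d k c} := by
    intro x
    rw [hspan, Ideal.mem_span_range_iff_exists_fun]
    refine exists_congr fun y => ?_
    rw [Matrix.mulVecLin_apply]
    constructor
    · rintro rfl
      simp [Matrix.mulVec, dotProduct, mul_comm]
    · intro h
      ext1 k
      rw [Subsingleton.elim k 0, ← h]
      simp [Matrix.mulVec, dotProduct, mul_comm]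
  constructor
  · rintro rfl
    ext x
    rw [hmem]
    simp [Submodule.mem_pi]
  · intro h
    ext f
    have h1 := hmem fun _ => f
    rw [h] at h1
    rw [← h1]
    simp [Submodule.mem_pi]

/-- One map of a graded free resolution: a homogeneous matrix whose syzygies have entries without
constant term. -/
structure ResolutionStep (K : Type*) [Field K] (A : Matrix V ι ℤ) where
  /-- The rank of the target. -/
  r : ℕ
  /-- The rank of the source. -/
  q : ℕ
  /-- The basis degrees of the target. -/
  a : Fin r → V → ℤ
  /-- The basis degrees of the source. -/
  b : Fin q → V → ℤ
  /-- The matrix. -/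
  d : Matrix (Fin r) (Fin q) (MvPolynomial ι K)
  homogeneous : IsHomogeneousMatrix (fun j v => A v j) a b d
  minimal : ∀ y, d.mulVec y = 0 → ∀ j, constantCoeff (y j) = 0

/-- The next map of the resolution, given by minimal generators of the kernel. -/
noncomputable def ResolutionStep.next (hA : IsPositivelyGraded A) (s : ResolutionStep K A) :
    ResolutionStep K A :=
  let h := exists_minimal_generators hA s.homogeneous.isHomogeneousSubmodule_ker
  ⟨s.q, h.choose, s.b, h.choose_spec.choose, h.choose_spec.choose_spec.choose,
    h.choose_spec.choose_spec.choose_spec.1, h.choose_spec.choose_spec.choose_spec.2.2⟩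

theorem ResolutionStep.range_next (hA : IsPositivelyGraded A) (s : ResolutionStep K A) :
    LinearMap.range (s.next hA).d.mulVecLin = LinearMap.ker s.d.mulVecLin :=
  (exists_minimal_generators hA
    s.homogeneous.isHomogeneousSubmodule_ker).choose_spec.choose_spec.choose_spec.2.1

/-- The maps of the resolution that begins with the map `s`. -/
noncomputable def ResolutionStep.seq (hA : IsPositivelyGraded A) (s : ResolutionStep K A) (i : ℕ) :
    ResolutionStep K A :=
  Nat.rec s (fun _ t => t.next hA) i

theorem isHomogeneousSubmodule_pi_toricIdeal :
    IsHomogeneousSubmodule (fun j v => A v j) (fun _ : Fin 1 => (0 : V → ℤ))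
      (Submodule.pi Set.univ fun _ => toricIdeal K A) := by
  refine le_antisymm (Submodule.span_le.2 fun x hx => hx.1) fun x hx => ?_
  have h0 : x 0 ∈ toricIdeal K A := hx 0 (Set.mem_univ _)
  have hx0 : x = fun _ => x 0 := funext fun k => by rw [Subsingleton.elim k 0]
  rw [hx0]
  clear hx0 hx
  generalize x 0 = f at h0
  induction h0 using Submodule.span_induction with
  | mem f hf =>
    obtain ⟨u, hu, rfl⟩ := hf
    obtain ⟨h, hh⟩ := isWeightedHomogeneous_binomial (K := K) hu
    refine Submodule.subset_span ⟨fun _ _ => binomial_mem_toricIdeal_iff.2 hu, h, fun k => ?_⟩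
    rwa [sub_zero]
  | zero => exact zero_mem _
  | add f g _ _ hf hg => exact add_mem hf hg
  | smul c f _ hf => exact Submodule.smul_mem _ c hf

omit [Fintype ι] in
theorem constantCoeff_eq_zero_of_range_eq_ker {r q s : ℕ}
    {d : Matrix (Fin r) (Fin q) (MvPolynomial ι K)} {d' : Matrix (Fin q) (Fin s) (MvPolynomial ι K)}
    (h : LinearMap.range d'.mulVecLin = LinearMap.ker d.mulVecLin)
    (hmin : ∀ y, d.mulVec y = 0 → ∀ j, constantCoeff (y j) = 0) (k : Fin q) (c : Fin s) :
    constantCoeff (d' k c) = 0 := by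
  have h1 : d'.mulVecLin (Pi.single c 1) ∈ LinearMap.ker d.mulVecLin := h ▸ ⟨_, rfl⟩
  rw [Matrix.mulVecLin_apply, Matrix.mulVec_single_one] at h1
  exact hmin _ h1 k

theorem exists_isMinimalGradedFreeResolution (hA : IsPositivelyGraded A) :
    ∃ F : FreeComplex (MvPolynomial ι K) (V → ℤ), IsMinimalGradedFreeResolution A F := by
  obtain ⟨q, b, d, hd, hrange, hmin⟩ := exists_minimal_generators hA
    (isHomogeneousSubmodule_pi_toricIdeal (K := K) (A := A))
  let s : ResolutionStep K A := ⟨1, q, _, b, d, hd, hmin⟩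
  refine ⟨⟨fun i => (s.seq hA i).r, fun i => (s.seq hA i).a, fun i => (s.seq hA i).d⟩, ?_⟩
  exact
    { rank_zero := rfl
      deg_zero := fun _ => rfl
      homogeneous := fun i => (s.seq hA i).homogeneous
      span_eq := (span_entries_eq_iff rfl d _).2 hrange
      exact := fun i => LinearMap.exact_iff.2 ((s.seq hA i).range_next hA).symm
      minimal := fun i k c => by
        obtain _ | i := i
        · refine constantCoeff_of_mem_toricIdeal hA ?_
          rw [← (span_entries_eq_iff rfl d _).2 hrange]
          exact Ideal.subset_span ⟨k, c, rfl⟩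
        · exact constantCoeff_eq_zero_of_range_eq_ker ((s.seq hA i).range_next hA)
            (s.seq hA i).minimal k c }

end Existence

/-! ### Uniqueness of the Betti numbers -/

section Uniqueness

variable {V ι K : Type*} [Fintype ι] [Field K] {A : Matrix V ι ℤ}

/-- The image of `F_{i+1}` in `F_i`, described by exactness: the ideal `I_A` for `i = 0`, the kernel
of `F_i → F_{i-1}` otherwise. -/
noncomputable def cycles (A : Matrix V ι ℤ) (F : FreeComplex (MvPolynomial ι K) (V → ℤ)) :
    ∀ i, Submodule (MvPolynomial ι K) (Fin (F.rank i) → MvPolynomial ι K)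
  | 0 => Submodule.pi Set.univ fun _ => toricIdeal K A
  | i + 1 => LinearMap.ker (F.d i).mulVecLin

theorem mem_cycles_succ {F : FreeComplex (MvPolynomial ι K) (V → ℤ)} {i : ℕ}
    {x : Fin (F.rank (i + 1)) → MvPolynomial ι K} :
    x ∈ cycles A F (i + 1) ↔ (F.d i).mulVec x = 0 := Iff.rfl

variable {F G : FreeComplex (MvPolynomial ι K) (V → ℤ)}

namespace IsMinimalGradedFreeResolution

theorem range_d (hF : IsMinimalGradedFreeResolution A F) (i : ℕ) :
    LinearMap.range (F.d i).mulVecLin = cycles A F i := by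
  cases i with
  | zero => exact (span_entries_eq_iff hF.rank_zero _ _).1 hF.span_eq
  | succ i => exact (LinearMap.exact_iff.1 (hF.exact i)).symm

theorem mulVec_mem_cycles (hF : IsMinimalGradedFreeResolution A F) {i : ℕ}
    (y : Fin (F.rank (i + 1)) → MvPolynomial ι K) : (F.d i).mulVec y ∈ cycles A F i :=
  hF.range_d i ▸ ⟨y, rfl⟩

theorem isHomogeneousMatrix (hF : IsMinimalGradedFreeResolution A F) (i : ℕ) :
    IsHomogeneousMatrix (fun j v => A v j) (F.deg i) (F.deg (i + 1)) (F.d i) :=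
  hF.homogeneous i

theorem constantCoeff_mulVec (hF : IsMinimalGradedFreeResolution A F) {i : ℕ}
    (y : Fin (F.rank (i + 1)) → MvPolynomial ι K) (j : Fin (F.rank i)) :
    constantCoeff ((F.d i).mulVec y j) = 0 := by
  simp [Matrix.mulVec, dotProduct, hF.minimal]

/-- The basis of `F_{i+1}` maps to minimal generators. -/
theorem constantCoeff_eq_zero_of_mulVec_eq_zero (hF : IsMinimalGradedFreeResolution A F) {i : ℕ}
    {y : Fin (F.rank (i + 1)) → MvPolynomial ι K} (hy : (F.d i).mulVec y = 0)
    (j : Fin (F.rank (i + 1))) : constantCoeff (y j) = 0 := by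
  have h : y ∈ cycles A F (i + 1) := hy
  rw [← hF.range_d] at h
  obtain ⟨z, rfl⟩ := h
  exact hF.constantCoeff_mulVec z j

theorem constantCoeff_eq_of_mulVec_eq (hF : IsMinimalGradedFreeResolution A F) {i : ℕ}
    {y z : Fin (F.rank (i + 1)) → MvPolynomial ι K} (h : (F.d i).mulVec y = (F.d i).mulVec z)
    (j : Fin (F.rank (i + 1))) : constantCoeff (y j) = constantCoeff (z j) := by
  have := hF.constantCoeff_eq_zero_of_mulVec_eq_zero (y := y - z)
    (by rw [Matrix.mulVec_sub, h, sub_self]) j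
  rwa [Pi.sub_apply, map_sub, sub_eq_zero] at this

theorem exists_entry_ne_zero (hF : IsMinimalGradedFreeResolution A F) (i : ℕ)
    (c : Fin (F.rank (i + 1))) : ∃ k, F.d i k c ≠ 0 := by
  by_contra! h
  have h0 : (F.d i).mulVec (Pi.single c 1) = 0 := by
    rw [Matrix.mulVec_single_one]
    exact funext h
  simpa using hF.constantCoeff_eq_zero_of_mulVec_eq_zero h0 c

theorem exists_deg_eq_mulVec (hF : IsMinimalGradedFreeResolution A F) (i : ℕ)
    (j : Fin (F.rank i)) : ∃ u, F.deg i j = A.mulVec u := by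
  induction i with
  | zero => exact ⟨0, by rw [hF.deg_zero, Matrix.mulVec_zero]⟩
  | succ i ih =>
    obtain ⟨k, hk⟩ := hF.exists_entry_ne_zero i j
    obtain ⟨u, hu⟩ := ih k
    obtain ⟨c, hc⟩ := ne_zero_iff.1 hk
    have := hF.homogeneous i k j hc
    rw [weight_col_eq_mulVec, hu, eq_sub_iff_add_eq, ← Matrix.mulVec_add] at this
    exact ⟨_, this.symm⟩

end IsMinimalGradedFreeResolution

theorem exists_matrix_mul_eq {R : Type*} [CommRing R] {r q s : ℕ} {d : Matrix (Fin r) (Fin q) R}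
    {N : Matrix (Fin r) (Fin s) R} (h : ∀ c, N.col c ∈ LinearMap.range d.mulVecLin) :
    ∃ P : Matrix (Fin q) (Fin s) R, d * P = N := by
  choose y hy using h
  refine ⟨Matrix.of fun k c => y c k, ?_⟩
  ext k c
  exact congrFun (hy c) k

omit [Fintype ι] in
theorem exists_isHomogeneousMatrix_mul_eq {M : Type*} [AddCommGroup M] {w : ι → M} {r q s : ℕ}
    {a : Fin r → M} {b : Fin q → M} {e : Fin s → M}
    {d : Matrix (Fin r) (Fin q) (MvPolynomial ι K)} (hd : IsHomogeneousMatrix w a b d)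
    {N : Matrix (Fin r) (Fin s) (MvPolynomial ι K)} (hN : IsHomogeneousMatrix w a e N)
    (h : ∀ c, N.col c ∈ LinearMap.range d.mulVecLin) :
    ∃ P : Matrix (Fin q) (Fin s) (MvPolynomial ι K), IsHomogeneousMatrix w b e P ∧ d * P = N := by
  choose y hy hy' using fun c => hd.exists_isHomogeneousVec (h := e c) (x := N.col c)
    (fun k => hN k c) (h c)
  refine ⟨Matrix.of fun k c => y c k, fun k c => hy c k, ?_⟩
  ext1 k c
  exact congrFun (hy' c) k

theorem col_mul_eq_mulVec {R α β γ : Type*} [CommRing R] [Fintype β]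
    (M : Matrix α β R) (N : Matrix β γ R) (c : γ) : (M * N).col c = M.mulVec (N.col c) := rfl

/-- The next component of a homogeneous chain map between minimal graded free resolutions. -/
theorem exists_next_comparison (hF : IsMinimalGradedFreeResolution A F)
    (hG : IsMinimalGradedFreeResolution A G) {i : ℕ}
    {α : Matrix (Fin (G.rank i)) (Fin (F.rank i)) (MvPolynomial ι K)}
    (hα : IsHomogeneousMatrix (fun j v => A v j) (G.deg i) (F.deg i) α)
    (hcyc : ∀ x ∈ cycles A F i, α.mulVec x ∈ cycles A G i) :
    ∃ α' : Matrix (Fin (G.rank (i + 1))) (Fin (F.rank (i + 1))) (MvPolynomial ι K),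
      IsHomogeneousMatrix (fun j v => A v j) (G.deg (i + 1)) (F.deg (i + 1)) α' ∧
      (∀ x ∈ cycles A F (i + 1), α'.mulVec x ∈ cycles A G (i + 1)) ∧
      G.d i * α' = α * F.d i := by
  obtain ⟨α', hα', heq⟩ := exists_isHomogeneousMatrix_mul_eq (hG.isHomogeneousMatrix i)
    (hα.mul (hF.isHomogeneousMatrix i)) fun c => by
      rw [hG.range_d, col_mul_eq_mulVec]
      refine hcyc _ ?_
      rw [← Matrix.mulVec_single_one]
      exact hF.mulVec_mem_cycles _
  refine ⟨α', hα', fun x hx => ?_, heq⟩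
  rw [mem_cycles_succ] at hx ⊢
  rw [Matrix.mulVec_mulVec, heq, ← Matrix.mulVec_mulVec, hx, Matrix.mulVec_zero]

/-- A component of a chain endomorphism of `F` over the identity: its constant terms are those of
the identity, and on the cycles it is homotopic to the identity. -/
def IsNearIdentity (A : Matrix V ι ℤ) (F : FreeComplex (MvPolynomial ι K) (V → ℤ)) (i : ℕ)
    (γ : Matrix (Fin (F.rank i)) (Fin (F.rank i)) (MvPolynomial ι K)) : Prop :=
  γ.map constantCoeff = 1 ∧
    ∃ h : Matrix (Fin (F.rank (i + 1))) (Fin (F.rank i)) (MvPolynomial ι K),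
      ∀ x ∈ cycles A F i, γ.mulVec x = x + (F.d i).mulVec (h.mulVec x)

theorem IsNearIdentity.next (hF : IsMinimalGradedFreeResolution A F) {i : ℕ}
    {γ : Matrix (Fin (F.rank i)) (Fin (F.rank i)) (MvPolynomial ι K)}
    {γ' : Matrix (Fin (F.rank (i + 1))) (Fin (F.rank (i + 1))) (MvPolynomial ι K)}
    (hγ : IsNearIdentity A F i γ) (heq : F.d i * γ' = γ * F.d i) :
    IsNearIdentity A F (i + 1) γ' := by
  obtain ⟨-, h, hh⟩ := hγ
  obtain ⟨h', hh'⟩ := exists_matrix_mul_eq (d := F.d (i + 1)) (N := γ' - 1 - h * F.d i)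
    fun c => by
      rw [hF.range_d, mem_cycles_succ]
      have h1 : F.d i * (γ' - 1 - h * F.d i) = γ * F.d i - F.d i - F.d i * (h * F.d i) := by
        rw [Matrix.mul_sub, Matrix.mul_sub, Matrix.mul_one, heq]
      have h2 : (F.d i).mulVec ((γ' - 1 - h * F.d i).col c) =
          γ.mulVec ((F.d i).col c) - (F.d i).col c -
            (F.d i).mulVec (h.mulVec ((F.d i).col c)) := by
        rw [← col_mul_eq_mulVec, h1]
        rfl
      rw [h2, hh, add_sub_cancel_left, sub_self]
      rw [← Matrix.mulVec_single_one]
      exact hF.mulVec_mem_cycles _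
  have hγ' : γ' = 1 + h * F.d i + F.d (i + 1) * h' := by
    rw [hh']
    abel
  constructor
  · ext k c
    rw [hγ']
    have h1 : constantCoeff ((h * F.d i) k c) = 0 := by
      simp [Matrix.mul_apply, hF.minimal]
    have h2 : constantCoeff ((F.d (i + 1) * h') k c) = 0 := by
      simp [Matrix.mul_apply, hF.minimal]
    rw [Matrix.map_apply, Matrix.add_apply, Matrix.add_apply, map_add, map_add, h1, h2, add_zero,
      add_zero, Matrix.one_apply, Matrix.one_apply]
    split_ifs <;> simp
  · refine ⟨h', fun x hx => ?_⟩
    rw [mem_cycles_succ] at hx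
    rw [hγ', Matrix.add_mulVec, Matrix.add_mulVec, Matrix.one_mulVec, ← Matrix.mulVec_mulVec, hx,
      Matrix.mulVec_zero, add_zero, Matrix.mulVec_mulVec]

/-- Comparison of two minimal graded free resolutions. -/
theorem exists_comparison (hF : IsMinimalGradedFreeResolution A F)
    (hG : IsMinimalGradedFreeResolution A G) (i : ℕ) :
    ∃ (α : Matrix (Fin (G.rank i)) (Fin (F.rank i)) (MvPolynomial ι K))
      (β : Matrix (Fin (F.rank i)) (Fin (G.rank i)) (MvPolynomial ι K)),
      IsHomogeneousMatrix (fun j v => A v j) (G.deg i) (F.deg i) α ∧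
      IsHomogeneousMatrix (fun j v => A v j) (F.deg i) (G.deg i) β ∧
      (∀ x ∈ cycles A F i, α.mulVec x ∈ cycles A G i) ∧
      (∀ x ∈ cycles A G i, β.mulVec x ∈ cycles A F i) ∧
      IsNearIdentity A F i (β * α) ∧ IsNearIdentity A G i (α * β) := by
  induction i with
  | zero =>
    have hone : ∀ {r s : ℕ}, r = 1 → s = 1 →
        (Matrix.of fun _ _ => 1 : Matrix (Fin r) (Fin s) (MvPolynomial ι K)) *
          (Matrix.of fun _ _ => 1 : Matrix (Fin s) (Fin r) (MvPolynomial ι K)) = 1 := by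
      rintro _ _ rfl rfl
      ext1 k c
      rw [Subsingleton.elim c k]
      simp [Matrix.mul_apply]
    have hhom : ∀ F G : FreeComplex (MvPolynomial ι K) (V → ℤ),
        IsMinimalGradedFreeResolution A F → IsMinimalGradedFreeResolution A G →
        IsHomogeneousMatrix (fun j v => A v j) (G.deg 0) (F.deg 0)
          (Matrix.of fun _ _ => (1 : MvPolynomial ι K)) := fun F G hF hG k c => by
      rw [hF.deg_zero, hG.deg_zero, sub_zero]
      exact isWeightedHomogeneous_one _ _
    have hcyc : ∀ F G : FreeComplex (MvPolynomial ι K) (V → ℤ), ∀ x ∈ cycles A F 0,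
        (Matrix.of fun _ _ => (1 : MvPolynomial ι K)).mulVec x ∈ cycles A G 0 :=
      fun F G x hx k _ => by
        simp only [Matrix.mulVec, dotProduct]
        exact sum_mem fun c _ => Ideal.mul_mem_left _ _ (hx c (Set.mem_univ c))
    have hid : ∀ F : FreeComplex (MvPolynomial ι K) (V → ℤ), IsNearIdentity A F 0 1 := fun F =>
      ⟨Matrix.map_one _ (map_zero _) (map_one _), 0, fun x _ => by simp⟩
    refine ⟨Matrix.of fun _ _ => 1, Matrix.of fun _ _ => 1, hhom F G hF hG, hhom G F hG hF,
      hcyc F G, hcyc G F, ?_, ?_⟩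
    · rw [hone hF.rank_zero hG.rank_zero]
      exact hid F
    · rw [hone hG.rank_zero hF.rank_zero]
      exact hid G
  | succ i ih =>
    obtain ⟨α, β, hα, hβ, hαc, hβc, hβα, hαβ⟩ := ih
    obtain ⟨α', hα', hαc', hαeq⟩ := exists_next_comparison hF hG hα hαc
    obtain ⟨β', hβ', hβc', hβeq⟩ := exists_next_comparison hG hF hβ hβc
    refine ⟨α', β', hα', hβ', hαc', hβc', hβα.next hF ?_, hαβ.next hG ?_⟩
    · rw [← Matrix.mul_assoc, hβeq, Matrix.mul_assoc, hαeq, Matrix.mul_assoc]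
    · rw [← Matrix.mul_assoc, hαeq, Matrix.mul_assoc, hβeq, Matrix.mul_assoc]

/-- Inverse matrices that preserve degrees have equally many rows and columns in each degree. -/
theorem natCard_eq_of_inverse_matrices {Γ : Type*} {r s : ℕ} {a : Fin r → Γ} {b : Fin s → Γ}
    {P : Matrix (Fin s) (Fin r) K} {Q : Matrix (Fin r) (Fin s) K} (hQP : Q * P = 1)
    (hPQ : P * Q = 1) (hP : ∀ j k, P j k ≠ 0 → b j = a k) (hQ : ∀ k j, Q k j ≠ 0 → a k = b j)
    (h : Γ) : Nat.card {k // a k = h} = Nat.card {j // b j = h} := by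
  classical
  have key : ∀ {r s : ℕ} {a : Fin r → Γ} {b : Fin s → Γ} {P : Matrix (Fin s) (Fin r) K}
      {Q : Matrix (Fin r) (Fin s) K}, Q * P = 1 → (∀ j k, P j k ≠ 0 → b j = a k) →
      Q.submatrix (Subtype.val : {k // a k = h} → _) (Subtype.val : {j // b j = h} → _) *
        P.submatrix (Subtype.val : {j // b j = h} → _) (Subtype.val : {k // a k = h} → _) = 1 := by
    intro r s a b P Q hQP hP
    ext ⟨k, hk⟩ ⟨k', hk'⟩
    have h1 := congrFun (congrFun hQP k) k'
    rw [Matrix.mul_apply] at h1 ⊢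
    simp only [Matrix.submatrix_apply]
    rw [Matrix.one_apply] at h1 ⊢
    simp only [Subtype.mk.injEq]
    rw [← h1]
    rw [← Finset.sum_filter_of_ne (p := fun j => b j = h) fun j _ hj =>
      (hP j k' (right_ne_zero_of_mul hj)).trans hk']
    exact (Finset.sum_subtype _ (by simp) fun j => Q k j * P j k').symm
  have e := Matrix.toLin'OfInv (key hPQ hQ) (key hQP hP)
  have := e.finrank_eq
  rw [Module.finrank_fintype_fun_eq_card, Module.finrank_fintype_fun_eq_card] at this
  rw [Nat.card_eq_fintype_card, Nat.card_eq_fintype_card, this]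

omit [Fintype ι] in
theorem IsHomogeneousMatrix.deg_eq_of_constantCoeff_ne_zero {M : Type*} [AddCommGroup M]
    {w : ι → M} {r q : ℕ} {a : Fin r → M} {b : Fin q → M}
    {d : Matrix (Fin r) (Fin q) (MvPolynomial ι K)} (hd : IsHomogeneousMatrix w a b d) {k : Fin r}
    {c : Fin q} (h : constantCoeff (d k c) ≠ 0) : a k = b c := by
  have := hd k c (d := 0) h
  rw [map_zero] at this
  exact (sub_eq_zero.1 this.symm).symm

theorem IsMinimalGradedFreeResolution.betti_eq (hF : IsMinimalGradedFreeResolution A F)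
    (hG : IsMinimalGradedFreeResolution A G) (i : ℕ) :
    F.rank i = G.rank i ∧ ∀ h, F.betti i h = G.betti i h := by
  obtain ⟨α, β, hα, hβ, -, -, hβα, hαβ⟩ := exists_comparison hF hG i
  have h1 : β.map constantCoeff * α.map constantCoeff = 1 := by
    rw [← Matrix.map_mul, hβα.1]
  have h2 : α.map constantCoeff * β.map constantCoeff = 1 := by
    rw [← Matrix.map_mul, hαβ.1]
  constructor
  · simpa using natCard_eq_of_inverse_matrices (a := fun _ => ()) (b := fun _ => ()) h1 h2
      (fun _ _ _ => rfl) (fun _ _ _ => rfl) ()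
  · exact natCard_eq_of_inverse_matrices h1 h2
      (fun _ _ h => hα.deg_eq_of_constantCoeff_ne_zero h)
      (fun _ _ h => hβ.deg_eq_of_constantCoeff_ne_zero h)

end Uniqueness

/-! ### Projective dimension from a minimal resolution -/

section ProjectiveDimension

open CategoryTheory

variable {V : Type*} {ι : Type} {K : Type*} [Fintype ι] [Field K] {A : Matrix V ι ℤ}
  {F : FreeComplex (MvPolynomial ι K) (V → ℤ)}

/-- The `i`-th syzygy module `F_i / im(F_{i+1})`. -/
abbrev syzygyModule (A : Matrix V ι ℤ) (F : FreeComplex (MvPolynomial ι K) (V → ℤ)) (i : ℕ) :=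
  (Fin (F.rank i) → MvPolynomial ι K) ⧸ cycles A F i

namespace IsMinimalGradedFreeResolution

/-- If the syzygy module is projective, then the image of `F_{i+1}` is a direct summand of `F_i`
contained in `𝔪 F_i`, so its minimal generators lie in `𝔪` times it. -/
theorem projective_syzygyModule_iff (hF : IsMinimalGradedFreeResolution A F) (i : ℕ) :
    Module.Projective (MvPolynomial ι K) (syzygyModule A F i) ↔ F.rank (i + 1) = 0 := by
  constructor
  · intro hproj
    by_contra hne
    let c : Fin (F.rank (i + 1)) := ⟨0, Nat.pos_of_ne_zero hne⟩
    obtain ⟨s, hs⟩ := Module.projective_lifting_property (cycles A F i).mkQ LinearMap.id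
      (cycles A F i).mkQ_surjective
    let ret : (Fin (F.rank i) → MvPolynomial ι K) →ₗ[MvPolynomial ι K]
      (Fin (F.rank i) → MvPolynomial ι K) := LinearMap.id - s ∘ₗ (cycles A F i).mkQ
    have hret : ∀ x, ret x ∈ LinearMap.range (F.d i).mulVecLin := fun x => by
      rw [hF.range_d, ← Submodule.ker_mkQ (cycles A F i), LinearMap.mem_ker]
      have := LinearMap.congr_fun hs ((cycles A F i).mkQ x)
      simp only [LinearMap.comp_apply, LinearMap.id_apply] at this
      simp only [ret, LinearMap.sub_apply, LinearMap.id_apply, LinearMap.comp_apply, map_sub, this,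
        sub_self]
    choose y hy using fun k => hret (Pi.single k 1)
    set z := (F.d i).mulVec (Pi.single c 1) with hz
    have hretz : ret z = z := by
      have : (cycles A F i).mkQ z = 0 := by
        rw [Submodule.mkQ_apply, Submodule.Quotient.mk_eq_zero]
        exact hF.mulVec_mem_cycles _
      simp only [ret, LinearMap.sub_apply, LinearMap.id_apply, LinearMap.comp_apply, this, map_zero,
        sub_zero]
    have hsum : (F.d i).mulVec (∑ k, z k • y k) = z := by
      rw [← Matrix.mulVecLin_apply, map_sum]
      simp only [map_smul, hy]
      conv_rhs => rw [← hretz, pi_eq_sum_univ' z]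
      rw [map_sum]
      simp only [map_smul]
    have h1 := hF.constantCoeff_eq_of_mulVec_eq (hsum.trans hz) c
    have h2 : ∀ k, constantCoeff (z k) = 0 := hF.constantCoeff_mulVec _
    simp [h2] at h1
  · intro h0
    have hbot : cycles A F i = ⊥ := by
      rw [← hF.range_d, LinearMap.range_eq_bot]
      ext1 y
      have : IsEmpty (Fin (F.rank (i + 1))) := by
        rw [h0]
        infer_instance
      exact isEmptyElim y
    exact Module.Projective.of_equiv (Submodule.quotEquivOfEqBot _ hbot).symm

theorem hasProjectiveDimensionLT_syzygyModule_iff (hF : IsMinimalGradedFreeResolution A F)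
    (i n : ℕ) :
    HasProjectiveDimensionLT (ModuleCat.of (MvPolynomial ι K) (syzygyModule A F i)) (n + 1) ↔
      F.rank (i + n + 1) = 0 := by
  induction n generalizing i with
  | zero =>
    rw [zero_add, ← projective_iff_hasProjectiveDimensionLT_one, ← IsProjective.iff_projective]
    exact hF.projective_syzygyModule_iff i
  | succ n ih =>
    have hS := LinearMap.shortExact_shortComplexKer (cycles A F i).mkQ_surjective
    have hproj : Projective (ModuleCat.of (MvPolynomial ι K)
        (Fin (F.rank i) → MvPolynomial ι K)) := by
      rw [← IsProjective.iff_projective]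
      infer_instance
    rw [← (by omega : i + 1 + n + 1 = i + (n + 1) + 1), ← ih (i + 1)]
    refine (hS.hasProjectiveDimensionLT_X₃_iff n hproj).trans ?_
    let e : syzygyModule A F (i + 1) ≃ₗ[MvPolynomial ι K] LinearMap.ker (cycles A F i).mkQ :=
      ((F.d i).mulVecLin.quotKerEquivRange).trans
        (LinearEquiv.ofEq _ _ (by rw [hF.range_d, Submodule.ker_mkQ]))
    exact ⟨fun _ => hasProjectiveDimensionLT_of_iso e.symm.toModuleIso _,
      fun _ => hasProjectiveDimensionLT_of_iso e.toModuleIso _⟩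

theorem hasProjectiveDimensionLT_succ_iff (hF : IsMinimalGradedFreeResolution A F) (n : ℕ) :
    HasProjectiveDimensionLT (ModuleCat.of (MvPolynomial ι K)
      (MvPolynomial ι K ⧸ toricIdeal K A)) (n + 1) ↔ F.rank (n + 1) = 0 := by
  rw [← zero_add n, ← hF.hasProjectiveDimensionLT_syzygyModule_iff 0 n, zero_add]
  have : Unique (Fin (F.rank 0)) := by
    rw [hF.rank_zero]
    infer_instance
  let e : syzygyModule A F 0 ≃ₗ[MvPolynomial ι K] MvPolynomial ι K ⧸ toricIdeal K A :=
    Submodule.Quotient.equiv _ _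
      (LinearEquiv.funUnique (Fin (F.rank 0)) (MvPolynomial ι K) (MvPolynomial ι K)) (by
        ext f
        constructor
        · rintro ⟨x, hx, rfl⟩
          exact hx _ (Set.mem_univ _)
        · exact fun hf => ⟨fun _ => f, fun _ _ => hf, rfl⟩)
  exact ⟨fun _ => hasProjectiveDimensionLT_of_iso e.symm.toModuleIso _,
      fun _ => hasProjectiveDimensionLT_of_iso e.toModuleIso _⟩

end IsMinimalGradedFreeResolution

theorem not_hasProjectiveDimensionLT_zero (hA : IsPositivelyGraded A) :
    ¬ HasProjectiveDimensionLT (ModuleCat.of (MvPolynomial ι K)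
      (MvPolynomial ι K ⧸ toricIdeal K A)) 0 := by
  rw [hasProjectiveDimensionLT_zero_iff_isZero, ModuleCat.isZero_iff_subsingleton,
    not_subsingleton_iff_nontrivial]
  refine Ideal.Quotient.nontrivial_iff.2 fun h => ?_
  have := constantCoeff_of_mem_toricIdeal hA ((Ideal.eq_top_iff_one _).1 h)
  simp at this

/-- The projective dimension is determined by the vanishing of the ranks in a minimal
resolution. -/
theorem pdQuotient_eq_of_rank_eq {W : Type*} {τ : Type} [Fintype τ] {A' : Matrix W τ ℤ}
    {F' : FreeComplex (MvPolynomial τ K) (W → ℤ)} (hA : IsPositivelyGraded A)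
    (hA' : IsPositivelyGraded A') (hF : IsMinimalGradedFreeResolution A F)
    (hF' : IsMinimalGradedFreeResolution A' F') (h : ∀ i, F.rank i = F'.rank i) :
    pdQuotient (toricIdeal K A) = pdQuotient (toricIdeal K A') := by
  have key : ∀ i, HasProjectiveDimensionLT (ModuleCat.of (MvPolynomial ι K)
      (MvPolynomial ι K ⧸ toricIdeal K A)) i ↔ HasProjectiveDimensionLT
      (ModuleCat.of (MvPolynomial τ K) (MvPolynomial τ K ⧸ toricIdeal K A')) i := by
    intro i
    cases i with
    | zero =>
      exact iff_of_false (not_hasProjectiveDimensionLT_zero hA)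
        (not_hasProjectiveDimensionLT_zero hA')
    | succ n =>
      rw [hF.hasProjectiveDimensionLT_succ_iff, hF'.hasProjectiveDimensionLT_succ_iff, h]
  simp only [pdQuotient, projectiveDimension, key]

end ProjectiveDimension

/-! ### Resolutions under the flat extension `K[x] → K[y]` -/

section BaseChange

variable {σ τ V W K : Type*} [Fintype σ] [Fintype τ] [DecidableEq σ] [Field K]
  {p : τ → σ} {A : Matrix V σ ℤ} {A' : Matrix W τ ℤ}

omit [DecidableEq σ] in
theorem IsKernelLift.mulVec_comp_eq_iff (h : IsKernelLift p A A') (hp : Function.Surjective p)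
    {u v : σ → ℤ} : A'.mulVec (u ∘ p) = A'.mulVec (v ∘ p) ↔ A.mulVec u = A.mulVec v := by
  rw [mulVec_eq_iff_sub_mem, mulVec_eq_iff_sub_mem, ← h.comp_mem_iff hp]
  rfl

omit [DecidableEq σ] in
theorem IsKernelLift.exists_degree_map (h : IsKernelLift p A A') (hp : Function.Surjective p) :
    ∃ f : (V → ℤ) → (W → ℤ), ∀ u, f (A.mulVec u) = A'.mulVec (u ∘ p) := by
  classical
  refine ⟨fun g => if hg : ∃ u, A.mulVec u = g then A'.mulVec (hg.choose ∘ p) else 0, fun u => ?_⟩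
  have hu : ∃ v, A.mulVec v = A.mulVec u := ⟨u, rfl⟩
  beta_reduce
  rw [dif_pos hu, h.mulVec_comp_eq_iff hp]
  exact hu.choose_spec

omit [DecidableEq σ] in
/-- A monomial of `K[y]` with the degree of a lattice vector constant on blocks lies in the subring
`K[x]`. -/
theorem IsKernelLift.remainder_eq_zero (h : IsKernelLift p A A') (hp : Function.Surjective p)
    {c : τ →₀ ℕ} {u : σ → ℤ}
    (hc : Finsupp.weight (fun j v => A' v j) c = A'.mulVec (u ∘ p)) : remainder p c = 0 := by
  rw [weight_col_eq_mulVec, mulVec_eq_iff_sub_mem] at hc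
  obtain ⟨v, -, hv⟩ := h.exists_of_mem hc
  have hconst : ∀ e, (c e : ℤ) = u (p e) + v (p e) := fun e => by
    have := congrFun hv e
    simp only [Function.comp_apply, Pi.sub_apply] at this
    omega
  have hcore : pullExp p (core p c) = c := by
    ext e
    obtain ⟨e', he', hce'⟩ := exists_core_eq hp c (p e)
    rw [pullExp_apply, ← hce']
    have h1 := hconst e
    have h2 := hconst e'
    rw [he'] at h2
    omega
  rw [remainder, hcore, tsub_self]

omit [DecidableEq σ] in
theorem weight_eq_mulVec_core {c : τ →₀ ℕ}
    (hc : remainder p c = 0) :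
    Finsupp.weight (fun j v => A' v j) c = A'.mulVec ((fun i => (core p c i : ℤ)) ∘ p) := by
  have h := pullExp_core_add_remainder p c
  rw [hc, add_zero] at h
  rw [weight_col_eq_mulVec]
  conv_lhs => rw [← h]
  rfl

theorem liftHom_coordAt_zero {t : MvPolynomial τ K} (h : ∀ c ∈ t.support, remainder p c = 0) :
    liftHom K p (coordAt K p 0 t) = t := by
  have := sum_liftHom_coordAt (K := K) p t (s := {0}) fun c hc => Finset.mem_singleton.2 (h c hc)
  rwa [Finset.sum_singleton, ← C_apply, C_1, mul_one] at this

theorem coordAt_zero_eq_zero (hp : Function.Surjective p) {t : MvPolynomial τ K}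
    (h : ∀ c ∈ t.support, remainder p c ≠ 0) : coordAt K p 0 t = 0 := by
  ext v
  rw [coeff_coordAt hp (core_zero hp), add_zero, coeff_zero]
  by_contra hne
  exact h _ (mem_support_iff.2 hne) (remainder_pullExp hp v)

theorem IsKernelLift.isWeightedHomogeneous_liftHom_iff (h : IsKernelLift p A A')
    (hp : Function.Surjective p) {g : MvPolynomial σ K} {u v : σ → ℤ} :
    IsWeightedHomogeneous (fun j v => A' v j) (liftHom K p g)
        (A'.mulVec (u ∘ p) - A'.mulVec (v ∘ p)) ↔
      IsWeightedHomogeneous (fun j v => A v j) g (A.mulVec u - A.mulVec v) := by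
  have hw : ∀ c : σ →₀ ℕ, Finsupp.weight (fun j v => A' v j) (pullExp p c) =
      A'.mulVec (u ∘ p) - A'.mulVec (v ∘ p) ↔
      Finsupp.weight (fun j v => A v j) c = A.mulVec u - A.mulVec v := by
    intro c
    rw [weight_col_eq_mulVec, weight_col_eq_mulVec, ← Matrix.mulVec_sub, ← Matrix.mulVec_sub]
    exact h.mulVec_comp_eq_iff hp (u := fun i => (c i : ℤ)) (v := u - v)
  constructor
  · intro hg c hc
    exact (hw c).1 (hg (mem_support_iff.1
      ((mem_support_liftHom_iff hp).2 ⟨c, mem_support_iff.2 hc, rfl⟩)))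
  · intro hg c' hc'
    obtain ⟨c, hc, rfl⟩ := (mem_support_liftHom_iff hp).1 (mem_support_iff.2 hc')
    exact (hw c).2 (hg (mem_support_iff.1 hc))

theorem mulVec_map_liftHom {α β : Type*} [Fintype β] (M : Matrix α β (MvPolynomial σ K))
    (x : β → MvPolynomial σ K) : (M.map (liftHom K p)).mulVec (fun j => liftHom K p (x j)) =
      fun a => liftHom K p (M.mulVec x a) :=
  funext fun a => map_liftHom_mulVec p M x a

theorem liftHom_comp_eq_zero_iff (hp : Function.Surjective p) {α : Type*}
    {x : α → MvPolynomial σ K} : (fun a => liftHom K p (x a)) = 0 ↔ x = 0 := by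
  simp only [funext_iff, Pi.zero_apply, map_eq_zero_iff _ (liftHom_injective hp)]

/-- `K[y]` is faithfully flat over `K[x]`. -/
theorem exact_map_liftHom_iff (hp : Function.Surjective p) {α β γ : Type*} [Fintype β]
    [Fintype γ] {M : Matrix α β (MvPolynomial σ K)} {N : Matrix β γ (MvPolynomial σ K)} :
    Function.Exact (N.map (liftHom K p)).mulVecLin (M.map (liftHom K p)).mulVecLin ↔
      Function.Exact N.mulVecLin M.mulVecLin := by
  classical
  constructor
  · intro hex x
    have h1 := hex (fun j => liftHom K p (x j))
    simp only [Matrix.mulVecLin_apply, mulVec_map_liftHom, liftHom_comp_eq_zero_iff hp] at h1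
    rw [Matrix.mulVecLin_apply, h1]
    constructor
    · rintro ⟨y, hy⟩
      refine ⟨fun j => coordAt K p 0 (y j), funext fun k => ?_⟩
      rw [Matrix.mulVecLin_apply] at hy ⊢
      rw [← coordAt_map_mulVec hp, hy, coordAt_liftHom hp, if_pos rfl]
    · rintro ⟨y, rfl⟩
      exact ⟨fun j => liftHom K p (y j), by
        rw [Matrix.mulVecLin_apply, mulVec_map_liftHom, Matrix.mulVecLin_apply]⟩
  · intro hex y
    constructor
    · intro hy
      rw [Matrix.mulVecLin_apply] at hy
      have h1 : ∀ b, ∃ z, N.mulVec z = fun j => coordAt K p b (y j) := fun b =>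
        (hex _).1 <| by
          ext1 a
          rw [Matrix.mulVecLin_apply, ← coordAt_map_mulVec hp, hy, Pi.zero_apply, map_zero,
            Pi.zero_apply]
      choose z hz using h1
      obtain ⟨s, -, hs⟩ := exists_forall_sum_liftHom_coordAt p y
      refine ⟨∑ b ∈ s, (monomial b 1 : MvPolynomial τ K) • fun j => liftHom K p (z b j), ?_⟩
      rw [map_sum]
      ext1 j
      simp only [map_smul, Matrix.mulVecLin_apply, mulVec_map_liftHom, hz, Finset.sum_apply,
        Pi.smul_apply, smul_eq_mul]
      rw [← hs j]
      exact Finset.sum_congr rfl fun b _ => by rw [mul_comm, hs j]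
    · rintro ⟨x, rfl⟩
      have hMN : M * N = 0 := by
        refine Matrix.ext_of_mulVec_single fun i => ?_
        rw [← Matrix.mulVec_mulVec, Matrix.zero_mulVec]
        exact (hex _).2 ⟨_, rfl⟩
      rw [Matrix.mulVecLin_apply, Matrix.mulVecLin_apply, Matrix.mulVec_mulVec]
      have := Matrix.map_mul (L := M) (M := N) (f := (liftHom K p : _ →+* MvPolynomial τ K))
      rw [hMN] at this
      have h0 : M.map (liftHom K p) * N.map (liftHom K p) = 0 := by
        rw [Matrix.map_zero _ (map_zero _)] at this
        exact this.symm
      rw [h0, Matrix.zero_mulVec]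

variable {f : (V → ℤ) → (W → ℤ)}

omit [DecidableEq σ] in
theorem IsKernelLift.degree_map_injOn (h : IsKernelLift p A A') (hp : Function.Surjective p)
    (hf : ∀ u, f (A.mulVec u) = A'.mulVec (u ∘ p)) : Set.InjOn f (Set.range A.mulVec) := by
  rintro _ ⟨u, rfl⟩ _ ⟨v, rfl⟩ huv
  rwa [hf, hf, h.mulVec_comp_eq_iff hp] at huv

/-- Base change preserves and reflects minimal graded free resolutions. -/
theorem IsKernelLift.isMinimalGradedFreeResolution_baseChange_iff (h : IsKernelLift p A A')
    (hp : Function.Surjective p) (hf : ∀ u, f (A.mulVec u) = A'.mulVec (u ∘ p))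
    {F : FreeComplex (MvPolynomial σ K) (V → ℤ)} (hdeg : ∀ i j, ∃ u, F.deg i j = A.mulVec u) :
    IsMinimalGradedFreeResolution A' (F.baseChange (liftHom K p) f) ↔
      IsMinimalGradedFreeResolution A F := by
  have hhom : ∀ i k c, IsWeightedHomogeneous (fun j v => A' v j) (liftHom K p (F.d i k c))
      (f (F.deg (i + 1) c) - f (F.deg i k)) ↔
      IsWeightedHomogeneous (fun j v => A v j) (F.d i k c) (F.deg (i + 1) c - F.deg i k) := by
    intro i k c
    obtain ⟨u, hu⟩ := hdeg (i + 1) c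
    obtain ⟨v, hv⟩ := hdeg i k
    rw [hu, hv, hf, hf, h.isWeightedHomogeneous_liftHom_iff hp]
  have hzero : ∀ j, f (F.deg 0 j) = 0 ↔ F.deg 0 j = 0 := by
    intro j
    obtain ⟨u, hu⟩ := hdeg 0 j
    have h1 := h.mulVec_comp_eq_iff hp (u := u) (v := 0)
    rw [Matrix.mulVec_zero] at h1
    rw [hu, hf, ← h1]
    exact (Matrix.mulVec_zero A').symm ▸ Iff.rfl
  have hspan : Ideal.span {g | ∃ k c, g = (F.d 0).map (liftHom K p) k c} =
      (Ideal.span {g | ∃ k c, g = F.d 0 k c}).map (liftHom K p) := by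
    rw [Ideal.map_span]
    congr 1
    ext g
    constructor
    · rintro ⟨k, c, rfl⟩
      exact ⟨_, ⟨k, c, rfl⟩, rfl⟩
    · rintro ⟨_, ⟨k, c, rfl⟩, rfl⟩
      exact ⟨k, c, rfl⟩
  constructor
  · intro hF
    exact
      { rank_zero := hF.rank_zero
        deg_zero := fun j => (hzero j).1 (hF.deg_zero j)
        homogeneous := fun i k c => (hhom i k c).1 (hF.homogeneous i k c)
        span_eq := by
          apply map_liftHom_injective (K := K) hp
          rw [← h.toricIdeal_eq_map, ← hspan]
          exact hF.span_eq
        exact := fun i => (exact_map_liftHom_iff hp).1 (hF.exact i)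
        minimal := fun i k c => by
          rw [← constantCoeff_liftHom hp]
          exact hF.minimal i k c }
  · intro hF
    exact
      { rank_zero := hF.rank_zero
        deg_zero := fun j => (hzero j).2 (hF.deg_zero j)
        homogeneous := fun i k c => (hhom i k c).2 (hF.homogeneous i k c)
        span_eq := hspan.trans (by rw [hF.span_eq, h.toricIdeal_eq_map])
        exact := fun i => (exact_map_liftHom_iff hp).2 (hF.exact i)
        minimal := fun i k c => (constantCoeff_liftHom hp _).trans (hF.minimal i k c) }

/-- The coordinates of a cycle are cycles, as long as the maps so far are defined over `K[x]`. -/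
theorem IsKernelLift.liftHom_coordAt_mem_cycles (h : IsKernelLift p A A')
    (hp : Function.Surjective p) {F' : FreeComplex (MvPolynomial τ K) (W → ℤ)} {i : ℕ}
    (hd : ∀ j < i, ∀ k c, liftHom K p (coordAt K p 0 (F'.d j k c)) = F'.d j k c)
    {z : Fin (F'.rank i) → MvPolynomial τ K} (hz : z ∈ cycles A' F' i) (b : τ →₀ ℕ) :
    (fun k => liftHom K p (coordAt K p b (z k))) ∈ cycles A' F' i := by
  cases i with
  | zero =>
    intro k hk
    have h1 := hz k hk
    rw [h.toricIdeal_eq_map] at h1 ⊢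
    exact Ideal.mem_map_of_mem _ ((mem_map_liftHom_iff hp).1 h1 b)
  | succ i =>
    rw [mem_cycles_succ] at hz ⊢
    have hM : F'.d i = (Matrix.of fun k c => coordAt K p 0 (F'.d i k c)).map (liftHom K p) :=
      Matrix.ext fun k c => (hd i (Nat.lt_succ_self i) k c).symm
    rw [hM, mulVec_map_liftHom, liftHom_comp_eq_zero_iff hp]
    ext1 a
    rw [← coordAt_map_mulVec hp, ← hM, hz]
    simp

/-- A homogeneous matrix with degrees in the lattice of the degrees of `K[x]` is defined
over `K[x]`. -/
theorem IsKernelLift.liftHom_coordAt_entry (h : IsKernelLift p A A') (hp : Function.Surjective p)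
    {r q : ℕ} {a : Fin r → W → ℤ} {b : Fin q → W → ℤ}
    {d : Matrix (Fin r) (Fin q) (MvPolynomial τ K)}
    (hd : IsHomogeneousMatrix (fun j v => A' v j) a b d)
    (ha : ∀ k, ∃ u : σ → ℤ, a k = A'.mulVec (u ∘ p))
    (hb : ∀ c, ∃ u : σ → ℤ, b c = A'.mulVec (u ∘ p)) (k : Fin r) (c : Fin q) :
    liftHom K p (coordAt K p 0 (d k c)) = d k c := by
  refine liftHom_coordAt_zero fun m hm => ?_
  obtain ⟨u, hu⟩ := ha k
  obtain ⟨v, hv⟩ := hb c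
  have := hd k c (mem_support_iff.1 hm)
  rw [hu, hv, ← Matrix.mulVec_sub] at this
  exact h.remainder_eq_zero hp (u := v - u) this

/-- The degrees in a minimal graded free resolution of `K[y]/I_{A'}` come from degrees of `K[x]`. A
column of another degree would have coordinate `0` at `1`, so it would be a combination of cycles, its
other coordinates, with coefficients `y^b`, `b ≠ 0`; this contradicts minimality. -/
theorem IsKernelLift.exists_deg_eq (h : IsKernelLift p A A') (hp : Function.Surjective p)
    {F' : FreeComplex (MvPolynomial τ K) (W → ℤ)} (hF' : IsMinimalGradedFreeResolution A' F')
    (i : ℕ) : ∀ j ≤ i, ∀ k, ∃ u : σ → ℤ, F'.deg j k = A'.mulVec (u ∘ p) := by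
  classical
  induction i with
  | zero =>
    intro j hj k
    obtain rfl : j = 0 := by omega
    refine ⟨0, ?_⟩
    rw [hF'.deg_zero]
    exact (Matrix.mulVec_zero A').symm
  | succ i ih =>
    intro j hj
    rcases Nat.lt_or_eq_of_le hj with hj | rfl
    · exact ih j (Nat.lt_succ_iff.1 hj)
    intro c
    by_contra hc
    set z := (F'.d i).mulVec (Pi.single c 1) with hz
    have hzk : ∀ k, z k = F'.d i k c := fun k => by rw [hz, Matrix.mulVec_single_one]; rfl
    have hz0 : ∀ k, coordAt K p 0 (z k) = 0 := by
      refine fun k => coordAt_zero_eq_zero hp fun m hm hrem => hc ?_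
      obtain ⟨u, hu⟩ := ih i le_rfl k
      rw [hzk] at hm
      have := hF'.homogeneous i k c (mem_support_iff.1 hm)
      rw [weight_eq_mulVec_core hrem, hu, eq_sub_iff_add_eq, ← Matrix.mulVec_add] at this
      exact ⟨(fun i => (core p m i : ℤ)) + u, this.symm⟩
    have hcyc := fun b => h.liftHom_coordAt_mem_cycles hp (z := z) (fun j hj =>
      h.liftHom_coordAt_entry hp (hF'.isHomogeneousMatrix j) (ih j hj.le) (ih (j + 1) hj))
      (hF'.mulVec_mem_cycles _) b
    rw [← hF'.range_d] at hcyc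
    choose y hy using hcyc
    obtain ⟨s, hs0, hs⟩ := exists_forall_sum_liftHom_coordAt p z
    have hsum : (F'.d i).mulVec (∑ b ∈ s.erase 0, (monomial b 1 : MvPolynomial τ K) • y b) = z := by
      rw [← Matrix.mulVecLin_apply, map_sum]
      ext1 k
      simp only [map_smul, hy, Finset.sum_apply, Pi.smul_apply, smul_eq_mul]
      have hk := hs k
      rw [← Finset.add_sum_erase s _ hs0, hz0, map_zero, zero_mul, zero_add] at hk
      exact (Finset.sum_congr rfl fun b _ => mul_comm _ _).trans hk
    have h1 := hF'.constantCoeff_eq_of_mulVec_eq (hsum.trans hz) c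
    rw [Finset.sum_apply, map_sum, Finset.sum_eq_zero, Pi.single_eq_same, map_one] at h1
    · exact zero_ne_one h1
    · intro b hb
      rw [Pi.smul_apply, smul_eq_mul, map_mul, constantCoeff_monomial,
        if_neg (Finset.ne_of_mem_erase hb), zero_mul]

theorem IsKernelLift.bijOn_baseChange (h : IsKernelLift p A A') (hp : Function.Surjective p)
    (hf : ∀ u, f (A.mulVec u) = A'.mulVec (u ∘ p)) :
    Set.BijOn (FreeComplex.baseChange (liftHom K p) f)
      {F | IsMinimalGradedFreeResolution A F} {F | IsMinimalGradedFreeResolution A' F} := by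
  refine ⟨fun F hF => (h.isMinimalGradedFreeResolution_baseChange_iff hp hf
    hF.exists_deg_eq_mulVec).2 hF, ?_, ?_⟩
  · intro F hF G hG hFG
    have hFd := IsMinimalGradedFreeResolution.exists_deg_eq_mulVec hF
    have hGd := IsMinimalGradedFreeResolution.exists_deg_eq_mulVec hG
    clear hF hG
    obtain ⟨r, a, d⟩ := F
    obtain ⟨r', a', d'⟩ := G
    simp only [FreeComplex.baseChange, FreeComplex.mk.injEq] at hFG
    obtain ⟨rfl, h1, h2⟩ := hFG
    rw [heq_iff_eq] at h1 h2
    have ha : a = a' := by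
      ext1 i
      ext1 j
      obtain ⟨u, hu⟩ := hFd i j
      obtain ⟨v, hv⟩ := hGd i j
      exact h.degree_map_injOn hp hf ⟨u, hu.symm⟩ ⟨v, hv.symm⟩ (congrFun (congrFun h1 i) j)
    have hd : d = d' := by
      ext1 i
      exact Matrix.map_injective (liftHom_injective hp) (congrFun h2 i)
    rw [ha, hd]
  · intro F' hF'
    choose u hu using fun i => h.exists_deg_eq hp hF' i i le_rfl
    have hd := fun i => h.liftHom_coordAt_entry hp
      (IsMinimalGradedFreeResolution.isHomogeneousMatrix hF' i)
      (fun k => ⟨u i k, hu i k⟩) (fun c => ⟨u (i + 1) c, hu (i + 1) c⟩)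
    let G : FreeComplex (MvPolynomial σ K) (V → ℤ) :=
      ⟨F'.rank, fun i k => A.mulVec (u i k), fun i => Matrix.of fun k c => coordAt K p 0 (F'.d i k c)⟩
    have hG : G.baseChange (liftHom K p) f = F' := by
      have h1 : (fun i k => f (A.mulVec (u i k))) = F'.deg := by
        ext1 i
        ext1 k
        rw [hf, hu]
      have h2 : (fun i => (Matrix.of fun k c => coordAt K p 0 (F'.d i k c)).map (liftHom K p))
          = F'.d := by
        ext1 i
        exact Matrix.ext fun k c => hd i k c
      exact FreeComplex.ext rfl (heq_of_eq h1) (heq_of_eq h2)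
    refine ⟨G, ?_, hG⟩
    refine (h.isMinimalGradedFreeResolution_baseChange_iff hp hf fun i j => ⟨u i j, rfl⟩).1 ?_
    rw [hG]
    exact hF'

theorem IsKernelLift.betti_eq (h : IsKernelLift p A A') (hp : Function.Surjective p)
    {F : FreeComplex (MvPolynomial σ K) (V → ℤ)} {F' : FreeComplex (MvPolynomial τ K) (W → ℤ)}
    (hF : IsMinimalGradedFreeResolution A F) (hF' : IsMinimalGradedFreeResolution A' F') (i : ℕ) :
    F.rank i = F'.rank i ∧ ∀ u, F.betti i (A.mulVec u) = F'.betti i (A'.mulVec (u ∘ p)) := by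
  obtain ⟨f, hf⟩ := h.exists_degree_map hp
  have hbc := (h.isMinimalGradedFreeResolution_baseChange_iff hp hf hF.exists_deg_eq_mulVec).2 hF
  obtain ⟨h1, h2⟩ := hbc.betti_eq hF' i
  refine ⟨h1, fun u => ?_⟩
  rw [← h2]
  refine Nat.card_congr (Equiv.subtypeEquivRight fun j => ?_)
  obtain ⟨v, hv⟩ := hF.exists_deg_eq_mulVec i j
  change F.deg i j = _ ↔ f (F.deg i j) = _
  rw [hv, hf, h.mulVec_comp_eq_iff hp]

end BaseChange

/-! ### The incidence matrix of the hypergraph -/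

section Construction

variable {p n : ℕ} (E : Matrix (Fin p) (Fin n) ℕ)

/-- The index of the block of an edge. -/
def blockIndex (e : HEdge E) : Fin n := (ofLex e).1

/-- The row of `E` from which a row of the incidence matrix arises. -/
def rowIndex : HVertex E → Fin p
  | Sum.inl ⟨q, _⟩ => q.1.1
  | Sum.inr k => k.1

variable {E}

theorem blockIndex_surjective : Function.Surjective (blockIndex E) := fun i =>
  ⟨toLex ⟨i, 0⟩, rfl⟩

theorem mem_block {i : Fin n} {e : HEdge E} : e ∈ block E i ↔ blockIndex E e = i := by
  simp [block, blockIndex]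

theorem liftVec_eq_comp : liftVec E = fun u => u ∘ blockIndex E := by
  ext u e
  simp [liftVec, blockVec, blockIndex]

theorem liftPoly_eq_liftHom (K : Type*) [Field K] : liftPoly K E = liftHom K (blockIndex E) := rfl

theorem le_colMax (k : Fin p) (i : Fin n) : E k i ≤ colMax E i :=
  Finset.le_sup (f := fun k => E k i) (Finset.mem_univ k)

theorem colMax_pos (hE : IsPositivelyGraded (E.map (Nat.cast : ℕ → ℤ))) (i : Fin n) :
    0 < colMax E i := by
  by_contra h
  have h0 : ∀ k, E k i = 0 := fun k => by
    have := le_colMax (E := E) k i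
    omega
  have hmem : (Pi.single i 1 : Fin n → ℤ) ∈ kerLattice (E.map (Nat.cast : ℕ → ℤ)) := by
    rw [mem_kerLattice, Matrix.mulVec_single_one]
    ext k
    simp [h0]
  have := congrFun (hE _ hmem (Pi.single_nonneg.2 zero_le_one)) i
  simp at this

theorem exists_isFirstMax (hE : IsPositivelyGraded (E.map (Nat.cast : ℕ → ℤ))) (i : Fin n) :
    ∃ k, IsFirstMax E k i := by
  have hne : (Finset.univ : Finset (Fin p)).Nonempty := by
    rw [Finset.nonempty_iff_ne_empty]
    intro h
    have := colMax_pos hE i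
    simp [colMax, h] at this
  obtain ⟨k, -, hk⟩ := Finset.exists_mem_eq_sup _ hne fun k => E k i
  obtain ⟨k₀, hk₀, hmin⟩ := WellFounded.has_min (wellFounded_lt (α := Fin p))
    {k | E k i = colMax E i} ⟨k, hk.symm⟩
  exact ⟨k₀, hk₀, fun k' hk' h => hmin k' h hk'⟩

theorem sum_epsRow {k r : ℕ} (h : k ≤ r) : ∑ s, epsRow k r s = k := by
  simp only [epsRow, Finset.sum_boole]
  rw [Fin.card_filter_val_lt, min_eq_right h]

theorem hMatrix_inl_self (q : {q : Fin p × Fin n // IsFirstMax E q.1 q.2})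
    (r s : Fin (colMax E q.1.2 + 1)) :
    hMatrix E (Sum.inl ⟨q, r⟩) (toLex ⟨q.1.2, s⟩) = if r = s then 0 else 1 :=
  (dif_pos rfl).trans rfl

theorem hMatrix_inl_of_ne (q : {q : Fin p × Fin n // IsFirstMax E q.1 q.2})
    (r : Fin (colMax E q.1.2 + 1)) {l : Fin n} (hl : l ≠ q.1.2) (s : Fin (colMax E l + 1)) :
    hMatrix E (Sum.inl ⟨q, r⟩) (toLex ⟨l, s⟩) = epsRow (E q.1.1 l) (colMax E l + 1) s :=
  dif_neg hl

theorem sum_hMatrix_block (v : HVertex E) (l : Fin n) :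
    ∑ s, hMatrix E v (toLex ⟨l, s⟩) = E (rowIndex E v) l := by
  have hle : ∀ k, E k l ≤ colMax E l + 1 := fun k => (le_colMax k l).trans (Nat.le_succ _)
  rcases v with ⟨q, r⟩ | k
  · by_cases hl : l = q.1.2
    · subst hl
      simp only [hMatrix_inl_self]
      have h1 : ∀ s, (if r = s then (0 : ℤ) else 1) = 1 - if r = s then 1 else 0 := fun s => by
        split_ifs <;> simp
      simp only [h1, Finset.sum_sub_distrib, Finset.sum_ite_eq, Finset.mem_univ, if_true]
      have h2 : E (rowIndex E (Sum.inl ⟨q, r⟩)) q.1.2 = colMax E q.1.2 := q.2.1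
      rw [h2]
      simp
    · simp only [hMatrix_inl_of_ne q r hl]
      exact sum_epsRow (hle _)
  · exact sum_epsRow (hle _)

theorem hMatrix_mulVec (w : HEdge E → ℤ) (v : HVertex E) :
    (hMatrix E).mulVec w v = ∑ l, ∑ s, hMatrix E v (toLex ⟨l, s⟩) * w (toLex ⟨l, s⟩) :=
  (Equiv.sum_comp toLex fun e => hMatrix E v e * w e).symm.trans (Fintype.sum_sigma _)

/-- On vectors that are constant on the blocks the incidence matrix acts like `E`. -/
theorem hMatrix_mulVec_comp (u : Fin n → ℤ) (v : HVertex E) :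
    (hMatrix E).mulVec (u ∘ blockIndex E) v =
      (E.map (Nat.cast : ℕ → ℤ)).mulVec u (rowIndex E v) := by
  rw [hMatrix_mulVec, Matrix.mulVec, dotProduct]
  refine Finset.sum_congr rfl fun l _ => ?_
  rw [Matrix.map_apply, ← sum_hMatrix_block, Finset.sum_mul]
  rfl

theorem rowIndex_surjective : Function.Surjective (rowIndex E) := by
  intro k
  by_cases h : ∃ i, IsFirstMax E k i
  · obtain ⟨i, hi⟩ := h
    exact ⟨Sum.inl ⟨⟨(k, i), hi⟩, 0⟩, rfl⟩
  · exact ⟨Sum.inr ⟨k, not_exists.1 h⟩, rfl⟩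

/-- The rows with `Σ` in the `i`-th block force the vectors of the kernel to be constant on that
block. -/
theorem apply_eq_of_mem_kerLattice (hE : IsPositivelyGraded (E.map (Nat.cast : ℕ → ℤ)))
    {w : HEdge E → ℤ} (hw : w ∈ kerLattice (hMatrix E)) (i : Fin n)
    (r r' : Fin (colMax E i + 1)) : w (toLex ⟨i, r⟩) = w (toLex ⟨i, r'⟩) := by
  obtain ⟨k, hk⟩ := exists_isFirstMax hE i
  have hrow : ∀ r : Fin (colMax E i + 1), w (toLex ⟨i, r⟩) = ∑ s, w (toLex ⟨i, s⟩) +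
      ∑ l ∈ Finset.univ.erase i, ∑ s, epsRow (E k l) (colMax E l + 1) s * w (toLex ⟨l, s⟩) := by
    intro r
    have h0 := congrFun (mem_kerLattice.1 hw) (Sum.inl ⟨⟨(k, i), hk⟩, r⟩)
    rw [hMatrix_mulVec, ← Finset.add_sum_erase _ _ (Finset.mem_univ i)] at h0
    have h1 : ∑ s, hMatrix E (Sum.inl ⟨⟨(k, i), hk⟩, r⟩) (toLex ⟨i, s⟩) * w (toLex ⟨i, s⟩) =
        ∑ s, w (toLex ⟨i, s⟩) - w (toLex ⟨i, r⟩) := by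
      have h2 : ∀ s, hMatrix E (Sum.inl ⟨⟨(k, i), hk⟩, r⟩) (toLex ⟨i, s⟩) * w (toLex ⟨i, s⟩) =
          w (toLex ⟨i, s⟩) - if r = s then w (toLex ⟨i, s⟩) else 0 := fun s => by
        rw [hMatrix_inl_self ⟨(k, i), hk⟩ r s]
        split_ifs <;> simp
      simp only [h2, Finset.sum_sub_distrib, Finset.sum_ite_eq, Finset.mem_univ, if_true]
    have h3 : ∑ l ∈ Finset.univ.erase i, ∑ s,
          hMatrix E (Sum.inl ⟨⟨(k, i), hk⟩, r⟩) (toLex ⟨l, s⟩) * w (toLex ⟨l, s⟩) =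
        ∑ l ∈ Finset.univ.erase i, ∑ s, epsRow (E k l) (colMax E l + 1) s * w (toLex ⟨l, s⟩) := by
      refine Finset.sum_congr rfl fun l hl => Finset.sum_congr rfl fun s _ => ?_
      rw [hMatrix_inl_of_ne ⟨(k, i), hk⟩ r (Finset.ne_of_mem_erase hl)]
    rw [h1, h3, Pi.zero_apply] at h0
    linarith
  rw [hrow r, hrow r']

theorem isKernelLift_hMatrix (hE : IsPositivelyGraded (E.map (Nat.cast : ℕ → ℤ))) :
    IsKernelLift (blockIndex E) (E.map (Nat.cast : ℕ → ℤ)) (hMatrix E) := by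
  have hiff : ∀ u : Fin n → ℤ, (hMatrix E).mulVec (u ∘ blockIndex E) = 0 ↔
      (E.map (Nat.cast : ℕ → ℤ)).mulVec u = 0 := by
    intro u
    constructor
    · intro h
      ext k
      obtain ⟨v, rfl⟩ := rowIndex_surjective (E := E) k
      rw [← hMatrix_mulVec_comp, h]
      rfl
    · intro h
      ext v
      rw [hMatrix_mulVec_comp, h]
      rfl
  ext w
  constructor
  · intro hw
    have hw' : w = (fun i => w (toLex ⟨i, 0⟩)) ∘ blockIndex E :=
      funext fun e => apply_eq_of_mem_kerLattice hE hw (ofLex e).1 (ofLex e).2 0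
    refine ⟨fun i => w (toLex ⟨i, 0⟩), mem_kerLattice.2 ((hiff _).1 ?_), hw'.symm⟩
    rw [← hw']
    exact mem_kerLattice.1 hw
  · rintro ⟨u, hu, rfl⟩
    exact mem_kerLattice.2 ((hiff u).2 (mem_kerLattice.1 hu))

theorem hMatrix_eq_zero_or_one (v : HVertex E) (e : HEdge E) :
    hMatrix E v e = 0 ∨ hMatrix E v e = 1 := by
  rcases v with ⟨q, r⟩ | k
  · simp only [hMatrix, sigmaMatrix, epsRow]
    split_ifs <;> simp
  · simp only [hMatrix, epsRow]
    split_ifs <;> simp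

theorem exists_ne_of_blockIndex_eq (hE : IsPositivelyGraded (E.map (Nat.cast : ℕ → ℤ)))
    (e : HEdge E) : ∃ e', e' ≠ e ∧ blockIndex E e' = blockIndex E e := by
  have hpos := colMax_pos hE (ofLex e).1
  have : Nontrivial (Fin (colMax E (ofLex e).1 + 1)) := Fin.nontrivial_iff_two_le.2 (by omega)
  obtain ⟨s, hs⟩ := exists_ne (ofLex e).2
  refine ⟨toLex ⟨(ofLex e).1, s⟩, fun h => hs ?_, rfl⟩
  have h1 : (⟨(ofLex e).1, s⟩ : Sigma fun i : Fin n => Fin (colMax E i + 1)) = ofLex e := h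
  have h2 := (Sigma.ext_iff.1 h1).2
  exact eq_of_heq h2

/-- Distinct columns are distinct edges: otherwise the difference of two unit vectors would be in
the kernel, but it is not constant on blocks. -/
theorem exists_isIncidenceMatrix (hE : IsPositivelyGraded (E.map (Nat.cast : ℕ → ℤ))) :
    ∃ H : Hypergraph (HVertex E), IsIncidenceMatrix H (hMatrix E) := by
  classical
  have hinj : Function.Injective fun e : HEdge E => {v | hMatrix E v e = 1} := by
    intro e f hef
    by_contra hne
    have hcol : ∀ v, hMatrix E v e = hMatrix E v f := by
      intro v
      have h1 : hMatrix E v e = 1 ↔ hMatrix E v f = 1 := Set.ext_iff.1 hef v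
      rcases hMatrix_eq_zero_or_one v e with h | h <;>
        rcases hMatrix_eq_zero_or_one v f with h' | h' <;> simp_all
    have hmem : (Pi.single e 1 - Pi.single f 1 : HEdge E → ℤ) ∈ kerLattice (hMatrix E) := by
      rw [mem_kerLattice, Matrix.mulVec_sub, Matrix.mulVec_single_one, Matrix.mulVec_single_one]
      ext v
      simp [hcol v]
    obtain ⟨u, -, hu⟩ := (isKernelLift_hMatrix hE).exists_of_mem hmem
    obtain ⟨e', hne', he'⟩ := exists_ne_of_blockIndex_eq hE e
    have h1 := congrFun hu e
    have h2 := congrFun hu e'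
    simp only [Function.comp_apply, he', Pi.sub_apply, Pi.single_eq_same, Pi.single_eq_of_ne hne',
      Pi.single_eq_of_ne hne] at h1 h2
    rw [h1, Pi.single_apply] at h2
    split_ifs at h2 <;> omega
  refine ⟨⟨Set.univ, Set.range fun e : HEdge E => {v | hMatrix E v e = 1},
    fun _ _ => Set.subset_univ _⟩, rfl, Equiv.ofInjective _ hinj, fun v e => ⟨fun h => h, fun h => ?_⟩⟩
  exact (hMatrix_eq_zero_or_one v e).resolve_right h

theorem galeMultiple_hMatrix_one (hE : IsPositivelyGraded (E.map (Nat.cast : ℕ → ℤ)))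
    {e f : HEdge E} (h : blockIndex E e = blockIndex E f) : GaleMultiple (hMatrix E) e f 1 := by
  rw [(isKernelLift_hMatrix hE).galeMultiple_iff blockIndex_surjective, h]
  exact galeMultiple_refl _ _

theorem isSubbouquetDecomposition_block
    (hE : IsPositivelyGraded (E.map (Nat.cast : ℕ → ℤ))) :
    IsSubbouquetDecomposition (hMatrix E) (fun i => (block E i : Set (HEdge E))) := by
  refine ⟨fun i => ⟨?_, ?_⟩, ?_, ?_⟩
  · obtain ⟨e, he⟩ := blockIndex_surjective (E := E) i
    exact ⟨e, mem_block.2 he⟩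
  · intro e he f hf hne
    have h : blockIndex E e = blockIndex E f := (mem_block.1 he).trans (mem_block.1 hf).symm
    exact ⟨hne, ⟨1, galeMultiple_hMatrix_one hE h⟩, 1, galeMultiple_hMatrix_one hE h.symm⟩
  · intro i j hij
    rw [Set.disjoint_left]
    exact fun e he hf => hij ((mem_block.1 he).symm.trans (mem_block.1 hf))
  · exact Set.eq_univ_of_forall fun e => Set.mem_iUnion.2 ⟨blockIndex E e, mem_block.2 rfl⟩

theorem isNonMixed_block (hE : IsPositivelyGraded (E.map (Nat.cast : ℕ → ℤ))) {i : Fin n}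
    (h : ¬ IsFree (hMatrix E) (block E i)) : IsNonMixed (hMatrix E) (block E i) :=
  ⟨h, fun _ he _ hf _ => ⟨1, one_pos,
    galeMultiple_hMatrix_one hE ((mem_block.1 he).trans (mem_block.1 hf).symm)⟩⟩

theorem sign_mul_self_ediv_gcd {ι : Type*} {s : Finset ι} (hs : s.Nonempty) {g : ℤ} (hg : g ≠ 0) :
    g.sign * g / s.gcd (fun _ => g) = 1 := by
  have hgcd : s.gcd (fun _ => g) = |g| := by
    obtain ⟨i, hi⟩ := hs
    rw [Int.abs_eq_normalize, ← Finset.normalize_gcd]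
    exact normalize_eq_normalize (Finset.gcd_dvd hi) (Finset.dvd_gcd fun _ _ => dvd_rfl)
  rw [hgcd, Int.sign_mul_self_eq_abs]
  exact Int.ediv_self (abs_ne_zero.2 hg)

theorem isEncodingVector_blockVec (hE : IsPositivelyGraded (E.map (Nat.cast : ℕ → ℤ)))
    (i : Fin n) : IsEncodingVector (hMatrix E) (block E i) (blockVec E i) := by
  have hone : ∀ e ∈ block E i, blockVec E i e = 1 := fun e he => if_pos (mem_block.1 he)
  have hzero : ∀ e ∉ block E i, blockVec E i e = 0 := fun e he =>
    if_neg fun h => he (mem_block.2 h)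
  refine ⟨fun _ => ⟨?_, fun e he => ?_⟩, fun hfree => ?_⟩
  · ext e
    rw [Function.mem_support, Finset.mem_coe]
    refine ⟨fun h => by_contra fun hn => h (hzero e hn), fun h => ?_⟩
    rw [hone e h]
    exact one_ne_zero
  · rw [hone e he.1]
    exact one_pos
  · have hconst : ∀ e ∈ block E i, ∀ f ∈ block E i, gale (hMatrix E) e = gale (hMatrix E) f := by
      intro e he f hf
      ext k
      have := galeMultiple_hMatrix_one hE ((mem_block.1 he).trans (mem_block.1 hf).symm) k
      rw [one_mul] at this
      exact_mod_cast this
    simp only [IsFree, not_forall] at hfree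
    obtain ⟨e, he, hne⟩ := hfree
    obtain ⟨j, hj⟩ := Function.ne_iff.1 hne
    have hnonempty : (block E i).Nonempty := ⟨e, he⟩
    refine ⟨j, fun f hf => by rwa [hconst f hf e he], (block E i).min' hnonempty,
      Finset.isLeast_min' _ hnonempty, fun f => ?_⟩
    split_ifs with hf
    · rw [hone f hf, hconst _ (Finset.min'_mem _ hnonempty) e he, hconst f hf e he,
        Finset.gcd_congr rfl fun f hf => by rw [hconst f hf e he], sign_mul_self_ediv_gcd hnonempty hj]
    · exact hzero f hf

theorem subbouquetMatrix_mulVec {V ι τ : Type*} [Fintype ι] [Fintype τ] (A : Matrix V ι ℤ)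
    (c : τ → ι → ℤ) (u : τ → ℤ) :
    (subbouquetMatrix A c).mulVec u = A.mulVec (∑ t, u t • c t) := by
  ext v
  simp only [Matrix.mulVec, dotProduct, subbouquetMatrix, Finset.sum_apply, Pi.smul_apply,
    smul_eq_mul, Finset.sum_mul, Finset.mul_sum]
  rw [Finset.sum_comm]
  exact Finset.sum_congr rfl fun _ _ => Finset.sum_congr rfl fun _ _ => by ring

theorem kerLattice_subbouquetMatrix (hE : IsPositivelyGraded (E.map (Nat.cast : ℕ → ℤ))) :
    kerLattice (subbouquetMatrix (hMatrix E) (blockVec E)) =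
      kerLattice (E.map (Nat.cast : ℕ → ℤ)) := by
  ext u
  rw [← (isKernelLift_hMatrix hE).comp_mem_iff blockIndex_surjective, mem_kerLattice,
    subbouquetMatrix_mulVec, mem_kerLattice, ← congrFun (liftVec_eq_comp (E := E)) u]
  rfl

end Construction

end ToricHypergraph

theorem theorem4p1 {K : Type*} [Field K] {m n : ℕ} (D : Matrix (Fin m) (Fin n) ℤ)
    (hpos : IsPositivelyGraded D) (hne : toricIdeal K D ≠ ⊥) :
    -- the ideal is also defined by a matrix `E` of natural numbers
    (∃ (p : ℕ) (E : Matrix (Fin p) (Fin n) ℕ),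
      toricIdeal K (E.map (Nat.cast : ℕ → ℤ)) = toricIdeal K D) ∧
    ∀ (p : ℕ) (E : Matrix (Fin p) (Fin n) ℕ),
      toricIdeal K (E.map (Nat.cast : ℕ → ℤ)) = toricIdeal K D →
      ∃ H : Hypergraph (HVertex E), IsIncidenceMatrix H (hMatrix E) ∧
        -- the blocks of columns form a subbouquet decomposition with encoding vectors `blockVec E i`
        -- and subbouquet ideal `I_D`, all of whose non-free subbouquets are non-mixed
        IsSubbouquetDecomposition (hMatrix E) (fun i => (block E i : Set (HEdge E))) ∧
        (∀ i, IsEncodingVector (hMatrix E) (block E i) (blockVec E i)) ∧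
        (∀ i, ¬ IsFree (hMatrix E) (block E i) → IsNonMixed (hMatrix E) (block E i)) ∧
        toricIdeal K (subbouquetMatrix (hMatrix E) (blockVec E)) = toricIdeal K D ∧
        (IsStable (hMatrix E) ↔ IsStable D) ∧
        -- the bijective correspondences
        Set.BijOn (liftVec E) (kerLattice D) (kerLattice (hMatrix E)) ∧
        Set.BijOn (liftVec E) (graverBasis D) (graverBasis (hMatrix E)) ∧
        Set.BijOn (liftVec E) (circuits D) (circuits (hMatrix E)) ∧
        Set.BijOn (liftVec E) (indispensables K D) (indispensables K (hMatrix E)) ∧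
        Set.BijOn (fun M => liftVec E '' M)
          {M | IsMinimalMarkovBasis K D M} {M | IsMinimalMarkovBasis K (hMatrix E) M} ∧
        Set.BijOn (fun G => liftPoly K E '' G)
          (reducedGroebnerBases (toricIdeal K D))
          (reducedGroebnerBases (toricIdeal K (hMatrix E))) ∧
        -- the minimal graded free resolutions
        (∃ F : FreeComplex (MvPolynomial (Fin n) K) (Fin m → ℤ),
          IsMinimalGradedFreeResolution D F) ∧
        (∃ f : (Fin m → ℤ) → (HVertex E → ℤ),
          (∀ u, f (D.mulVec u) = (hMatrix E).mulVec (liftVec E u)) ∧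
          Set.InjOn f (Set.range D.mulVec) ∧
          Set.BijOn (FreeComplex.baseChange (liftPoly K E) f)
            {F | IsMinimalGradedFreeResolution D F}
            {F | IsMinimalGradedFreeResolution (hMatrix E) F}) ∧
        -- the Betti numbers and the projective dimension
        (∀ (F : FreeComplex (MvPolynomial (Fin n) K) (Fin m → ℤ))
          (F' : FreeComplex (MvPolynomial (HEdge E) K) (HVertex E → ℤ)),
          IsMinimalGradedFreeResolution D F → IsMinimalGradedFreeResolution (hMatrix E) F' →
          ∀ i, F.rank i = F'.rank i ∧
            ∀ u, F.betti i (D.mulVec u) = F'.betti i ((hMatrix E).mulVec (liftVec E u))) ∧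
        pdQuotient (toricIdeal K D) = pdQuotient (toricIdeal K (hMatrix E)) := by
  refine ⟨?_, fun p E hED => ?_⟩
  · obtain ⟨E, hE⟩ := exists_nat_matrix_kerLattice_eq hpos
    exact ⟨_, E, toricIdeal_eq_of_kerLattice_eq hE⟩
  have hker := kerLattice_eq_of_toricIdeal_eq hED
  have hE : IsPositivelyGraded (E.map (Nat.cast : ℕ → ℤ)) := fun u hu => hpos u (hker ▸ hu)
  have h : IsKernelLift (blockIndex E) D (hMatrix E) := by
    have := isKernelLift_hMatrix hE
    rwa [IsKernelLift, hker] at this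
  have hp := blockIndex_surjective (E := E)
  obtain ⟨H, hH⟩ := exists_isIncidenceMatrix hE
  obtain ⟨f, hf⟩ := h.exists_degree_map hp
  obtain ⟨F, hF⟩ := exists_isMinimalGradedFreeResolution (K := K) hpos
  obtain ⟨F', hF'⟩ := exists_isMinimalGradedFreeResolution (K := K) (h.isPositivelyGraded hp hpos)
  rw [liftVec_eq_comp, liftPoly_eq_liftHom]
  refine ⟨H, hH, isSubbouquetDecomposition_block hE, isEncodingVector_blockVec hE,
    fun i => isNonMixed_block hE,
    toricIdeal_eq_of_kerLattice_eq ((kerLattice_subbouquetMatrix hE).trans hker),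
    h.isStable_iff hp,
    h.bijOn hp subset_rfl (fun u _ => h.comp_mem_iff hp) subset_rfl,
    h.bijOn_graverBasis hp, h.bijOn_circuits hp, h.bijOn_indispensables hp,
    h.bijOn_minimalMarkovBases hp, ?_, ⟨F, hF⟩,
    ⟨f, hf, h.degree_map_injOn hp hf, h.bijOn_baseChange hp hf⟩,
    fun F F' hF hF' => h.betti_eq hp hF hF',
    pdQuotient_eq_of_rank_eq hpos (h.isPositivelyGraded hp hpos) hF hF'
      fun i => (h.betti_eq hp hF hF' i).1⟩
  rw [h.toricIdeal_eq_map]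
  exact bijOn_reducedGroebnerBases hp _
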